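/- Let $\mathcal X,\mathcal Y$ be Hilbert spaces over $\mathbb K\in\{\mathbb R,\mathbb C\}$, $\mathcal Y$ separable with orthonormal basis $(e_i)_i$, inner products being linear in the first argument, and let $A:\mathcal X\to\mathcal Y$ be a bounded linear operator. Let $\xi$ be a Gaussian white noise on $\mathcal Y$, i.e. a linear map $\xi:\mathcal Y\to L^2(\Omega,P)$ into the $\mathbb K$-valued square-integrable random variables on a probability space $(\Omega,P)$ such that for all $h,h'\in\mathcal Y$: if $\mathbb K=\mathbb R$, $\xi(h)\sim\mathcal N(0,\|h\|^2)$ and $\mathbb E\,\xi(h)\xi(h')=\langle h,h'\rangle$; if $\mathbb K=\mathbb C$, $\xi(h)\sim\mathcal{CN}(0,2\|h\|^2)$ (independent real and imaginary parts, each $\mathcal N(0,\|h\|^2)$) and $\mathbb E\,\xi(h)\overline{\xi(h')}=2\langle h,h'\rangle$. For $\sigma>0$ and $f\in\mathcal X$ let $\mathbb P_{\sigma,f}$ be the law of the data sequence $y_\sigma=(\langle Af,e_i\rangle+\sigma\,\xi(e_i))_i$. Let $(u_k)_{k\in I}$ be a countable family in $\mathcal X$ and $(I_\sigma)_{\sigma>0}$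 a family of finite subsets of $I$. Put $N_\sigma=|I_\sigma|$, $$M_\sigma=\sup_{k\in I_\sigma}\#\{k'\in I_\sigma:\ \Re\langle Au_k,Au_{k'}\rangle\ge 0\},\qquad \mathcal F_\sigma(\mu)=\Big\{\delta\,\|Au_k\|^{-1}u_k:\ k\in I_\sigma,\ \delta\in\mathbb K,\ |\delta|\ge\mu\Big\},$$ $$\gamma_\sigma(\mu)=\inf_{\phi}\Big[\mathbb P_{\sigma,0}(\phi(y_\sigma)=1)+\sup_{f\in\mathcal F_\sigma(\mu)}\mathbb P_{\sigma,f}(\phi(y_\sigma)=0)\Big],$$ the infimum being over all measurable functions $\phi$ of the data sequence with values in $\{0,1\}$. For families of non-negative numbers indexed by $\sigma>0$, write $a_\sigma\precsim b_\sigma$ (or $b_\sigma\succsim a_\sigma$) if $a_\sigma\le b_\sigma$ for all sufficiently small $\sigma$, and $a_\sigma\asymp b_\sigma$ if $a_\sigma/b_\sigma\to1$ as $\sigma\to0$. A family $(\mu^*_\sigma)_{\sigma>0}$ of non-negative numbers is called an (asymptotic minimax) detection boundary if there are families $(\mu^L_\sigma),(\mu^U_\sigma)$ of non-negative numbers with $\mu^L_\sigma\asymp\mu^U_\sigma$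 and $\mu_\sigma^L\precsim\mu^*_\sigma\precsim\mu^U_\sigma$ such that $\gamma_\sigma(\mu_\sigma)\to0$ for every $(\mu_\sigma)$ with $\mu_\sigma\succsim\mu^U_\sigma$, and $\gamma_\sigma(\mu_\sigma)\to1$ for every $(\mu_\sigma)$ with $\mu_\sigma\precsim\mu^L_\sigma$, as $\sigma\to0$. **Statement.** Assume that, as $\sigma\to0$, $N_\sigma\to\infty$ and $M_\sigma N_\sigma^{-\varepsilon_\sigma}\to0$ for a family $(\varepsilon_\sigma)_{\sigma>0}$ of real numbers with $\varepsilon_\sigma\to0$ and $\varepsilon_\sigma\sqrt{\log N_\sigma}\to\infty$. Then the detection boundary exists and satisfies $\mu^*_\sigma\asymp\sqrt{2\sigma^2\log N_\sigma}$: the family $\big(\sqrt{2\sigma^2\log N_\sigma}\big)_{\sigma>0}$ is a detection boundary, and every detection boundary $(\mu^*_\sigma)$ satisfies $\mu^*_\sigma\asymp\sqrt{2\sigma^2\log N_\sigma}$. -/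

import Mathlib

open MeasureTheory ProbabilityTheory Filter Topology
open scoped ENNReal NNReal ComplexConjugate

noncomputable section

namespace InverseDetection

/-- `a ≾ b` as `σ → 0`: there is `σ₀ > 0` with `a σ ≤ b σ` for all `0 < σ < σ₀`. -/
def EventuallyLE (a b : ℝ → ℝ) : Prop :=
  ∃ σ₀ > 0, ∀ σ, 0 < σ → σ < σ₀ → a σ ≤ b σ

/-- `a ≍ b`: the quotient `a σ / b σ` tends to `1` as `σ → 0`, `σ > 0`. -/
def AsympEquiv (a b : ℝ → ℝ) : Prop :=
  Tendsto (fun σ => a σ / b σ) (𝓝[>] 0) (𝓝 1)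

/-- The law of `X₁ + i X₂` with independent `X₁, X₂ ∼ N(0, v)`.  For `𝕜 = ℂ` this is the complex
normal law `CN(0, 2v)`; for `𝕜 = ℝ` one has `RCLike.I = 0`, so that it is `N(0, v)`. -/
def noiseLaw (𝕜 : Type*) [RCLike 𝕜] (v : ℝ≥0) : Measure 𝕜 :=
  ((gaussianReal 0 v).prod (gaussianReal 0 v)).map
    (fun p : ℝ × ℝ => (p.1 : 𝕜) + (p.2 : 𝕜) * (RCLike.I : 𝕜))

section Model

variable {𝕜 X Y Ω ι I : Type*} [RCLike 𝕜]
  [NormedAddCommGroup X] [InnerProductSpace 𝕜 X]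
  [NormedAddCommGroup Y] [InnerProductSpace 𝕜 Y]
  [MeasurableSpace Ω]

/-- Gaussian white noise on the Hilbert space `Y`: a linear map `ξ : Y → L²(Ω, P)` with
`ξ(h) ∼ N(0, ‖h‖²)` and `E ξ(h) ξ(h') = ⟨h, h'⟩` in the real case, and
`ξ(h) ∼ CN(0, 2‖h‖²)` and `E ξ(h) conj(ξ(h')) = 2 ⟨h, h'⟩` in the complex case, where `⟨·,·⟩` is
linear in its first argument (Mathlib's `inner 𝕜 h' h`).  The factor `1` resp. `2` is the real
dimension of `𝕜`. -/
structure IsGaussianWhiteNoise (P : Measure Ω) (ξ : Y →ₗ[𝕜] Lp 𝕜 2 P) : Prop where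
  law_eq : ∀ h : Y, P.map (fun ω => ξ h ω) = noiseLaw 𝕜 (‖h‖₊ ^ 2)
  covariance_eq : ∀ h h' : Y,
    ∫ ω, ξ h ω * conj (ξ h' ω) ∂P = (Module.finrank ℝ 𝕜 : 𝕜) * inner 𝕜 h' h

/-- The observation `Y_σ(h) = ⟨A f, h⟩ + σ ξ(h)` (inner product linear in its first argument). -/
def observation (A : X →L[𝕜] Y) {P : Measure Ω} (ξ : Y →ₗ[𝕜] Lp 𝕜 2 P)
    (σ : ℝ) (f : X) (h : Y) (ω : Ω) : 𝕜 :=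
  inner 𝕜 h (A f) + (σ : 𝕜) * ξ h ω

/-- The distribution `P_f` of the data sequence `y_σ = (Y_σ(e_i))_i` when the signal is `f`. -/
def dataLaw (A : X →L[𝕜] Y) {P : Measure Ω} (ξ : Y →ₗ[𝕜] Lp 𝕜 2 P)
    (e : HilbertBasis ι 𝕜 Y) (σ : ℝ) (f : X) : Measure (ι → 𝕜) :=
  P.map (fun ω i => observation A ξ σ f (e i) ω)

/-- The minimax error of testing `f = 0` against `f ∈ F`: the infimum over all tests, i.e.
measurable functions `φ` of the data sequence with values in `{0, 1}`, of the type I error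
probability plus the largest type II error probability. -/
def minimaxError (A : X →L[𝕜] Y) {P : Measure Ω} (ξ : Y →ₗ[𝕜] Lp 𝕜 2 P)
    (e : HilbertBasis ι 𝕜 Y) (σ : ℝ) (F : Set X) : ℝ≥0∞ :=
  ⨅ φ : {φ : (ι → 𝕜) → Fin 2 // Measurable φ},
    (dataLaw A ξ e σ 0 {y | φ.1 y = 1} + ⨆ f ∈ F, dataLaw A ξ e σ f {y | φ.1 y = 0})

/-- The alternative `{δ ‖A u_k‖⁻¹ u_k : k ∈ J, |δ| ≥ μ}`, with scalars `δ ∈ 𝕜`. -/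
def alternative (A : X →L[𝕜] Y) (u : I → X) (J : Finset I) (μ : ℝ) : Set X :=
  {f | ∃ k ∈ J, ∃ δ : 𝕜, μ ≤ ‖δ‖ ∧ f = δ • (((‖A (u k)‖⁻¹ : ℝ) : 𝕜) • u k)}

open Classical in
/-- `sup_{k ∈ J} #{k' ∈ J : Re ⟨A u_k, A u_k'⟩ ≥ 0}`. -/
def maxNonnegCorrelated (A : X →L[𝕜] Y) (u : I → X) (J : Finset I) : ℕ :=
  J.sup fun k => (J.filter fun k' => 0 ≤ RCLike.re (inner 𝕜 (A (u k)) (A (u k')))).card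

end Model

/-- `μs` is an asymptotic minimax detection boundary for the minimax errors `γ σ μ` (noise level
`σ`, amplitude bound `μ`): it lies eventually between families `μL ≍ μU` of non-negative numbers
such that testing is indistinguishable for every `μ ≾ μL`, and distinguishable for every
`μ ≿ μU`. -/
def IsDetectionBoundary (γ : ℝ → ℝ → ℝ≥0∞) (μs : ℝ → ℝ) : Prop :=
  (∀ σ, 0 < σ → 0 ≤ μs σ) ∧
  ∃ μL μU : ℝ → ℝ, (∀ σ, 0 < σ → 0 ≤ μL σ) ∧ (∀ σ, 0 < σ → 0 ≤ μU σ) ∧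
    (∀ μ : ℝ → ℝ, (∀ σ, 0 < σ → 0 ≤ μ σ) → EventuallyLE μU μ →
      Tendsto (fun σ => γ σ (μ σ)) (𝓝[>] 0) (𝓝 0)) ∧
    (∀ μ : ℝ → ℝ, (∀ σ, 0 < σ → 0 ≤ μ σ) → EventuallyLE μ μL →
      Tendsto (fun σ => γ σ (μ σ)) (𝓝[>] 0) (𝓝 1)) ∧
    AsympEquiv μL μU ∧ EventuallyLE μL μs ∧ EventuallyLE μs μU

end InverseDetection

end

/-! Only the unit vectors `v k = A u_k / ‖A u_k‖` matter. With `N = |J σ|`, put `τ = √(2 log N)` and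
`s = √(ε log N)`. The hypotheses say exactly what is needed: `s → ∞`, `s / τ → 0` and `M exp(-s²) =
M N^(-ε) → 0`. The transition takes place between `σ (τ - s)` and `σ (τ + 3s)`, which are equivalent
to `σ τ`.

Above the window a maximum test over the `N` directions works (`minimaxError_le`): a union bound
shows that the noise rarely passes the threshold `σ (τ + s)`, and a signal beyond it by more than `σ
s` is missed only if a single noise variable exceeds `s` in modulus.

Below the window the supremum over the alternative is replaced by the average over `k` of the
signals of amplitude `σ a`, `a = τ - s`. The total error is at least one minus the `L²` distance
from `1` of the averaged likelihood ratio. The plain second moment is too large, because positively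
correlated pairs may contribute `exp(a²)`. So each ratio is cut off where the noise in direction `v
k` exceeds `τ = a + s`. This loses mass at most `exp(-s²/2)`, brings every pair down to at most `N
exp(-s²)`, and leaves pairs with nonpositive correlation at most `1`. As each `k` has at most `M`
other pairs, the squared distance is at most `2 exp(-s²/2) + M exp(-s²)`
(`integral_one_sub_average_sq_le`). The likelihood ratios come from the Cameron–Martin formula
`dataLaw_eq_map_withDensity`.

Uniqueness holds because the error cannot tend to `0` and to `1` at once, so the brackets of any two
boundaries interlock. -/

namespace InverseDetection

/-! ### Isonormal processes: independence and exponential change of measure -/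

section Isonormal

variable {Ω H : Type*} [MeasurableSpace Ω] [NormedAddCommGroup H] [InnerProductSpace ℝ H]

/-- A real isonormal process indexed by `H`: almost surely linear, with `W h ∼ N(0, ‖h‖²)`. -/
structure IsIsonormal (P : Measure Ω) (W : H → Ω → ℝ) : Prop where
  aemeasurable : ∀ h, AEMeasurable (W h) P
  map_eq : ∀ h, P.map (W h) = gaussianReal 0 (‖h‖₊ ^ 2)
  add_ae : ∀ g h, W (g + h) =ᵐ[P] fun ω => W g ω + W h ω
  smul_ae : ∀ (c : ℝ) (h), W (c • h) =ᵐ[P] fun ω => c * W h ω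

namespace IsIsonormal

variable {P : Measure Ω} {W : H → Ω → ℝ}

lemma integral_cexp (hW : IsIsonormal P W) (h : H) (z : ℂ) :
    ∫ ω, Complex.exp (z * W h ω) ∂P = Complex.exp ((‖h‖ : ℂ) ^ 2 * z ^ 2 / 2) := by
  have := complexMGF_gaussianReal (hW.map_eq h) z
  rw [complexMGF] at this
  simpa using this

lemma mgf_eq (hW : IsIsonormal P W) (h : H) (t : ℝ) :
    ∫ ω, Real.exp (t * W h ω) ∂P = Real.exp (‖h‖ ^ 2 * t ^ 2 / 2) := by
  have := mgf_gaussianReal (hW.map_eq h) t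
  rw [mgf] at this
  simpa using this

lemma integrable_exp (hW : IsIsonormal P W) (h : H) (t : ℝ) :
    Integrable (fun ω => Real.exp (t * W h ω)) P := by
  have h1 := integrable_exp_mul_gaussianReal (μ := 0) (v := ‖h‖₊ ^ 2) t
  rw [← hW.map_eq h] at h1
  exact h1.comp_aemeasurable (hW.aemeasurable h)

lemma linear_ae (hW : IsIsonormal P W) (a b : ℝ) (g h : H) :
    W (a • g + b • h) =ᵐ[P] fun ω => a * W g ω + b * W h ω := by
  filter_upwards [hW.add_ae (a • g) (b • h), hW.smul_ae a g, hW.smul_ae b h] with ω h1 h2 h3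
  rw [h1, h2, h3]

lemma sum_ae (hW : IsIsonormal P W) {κ : Type*} (s : Finset κ) (g : κ → H) :
    W (∑ i ∈ s, g i) =ᵐ[P] fun ω => ∑ i ∈ s, W (g i) ω := by
  classical
  induction s using Finset.induction_on with
  | empty =>
    filter_upwards [hW.smul_ae 0 0] with ω h1
    simpa using h1
  | insert a s ha ih =>
    rw [Finset.sum_insert ha]
    filter_upwards [hW.add_ae (g a) (∑ i ∈ s, g i), ih] with ω h1 h2
    rw [h1, h2, Finset.sum_insert ha]

/-- A linear combination of `W g` and `W h` is almost surely `W` of the combined vector, so the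
one-dimensional laws already determine the joint characteristic function. It factors by Pythagoras.
-/
lemma indepFun [IsProbabilityMeasure P] (hW : IsIsonormal P W) {g h : H}
    (hgh : inner ℝ g h = 0) : IndepFun (W g) (W h) P := by
  rw [indepFun_iff_charFun_prod (hW.aemeasurable g) (hW.aemeasurable h)]
  intro t
  rw [charFun_apply, hW.map_eq, hW.map_eq, charFun_gaussianReal, charFun_gaussianReal,
    integral_map, ← Complex.exp_add]
  · have h1 := hW.integral_cexp (t.ofLp.1 • g + t.ofLp.2 • h) Complex.I
    have h2 : ‖t.ofLp.1 • g + t.ofLp.2 • h‖ ^ 2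
        = t.ofLp.1 ^ 2 * ‖g‖ ^ 2 + t.ofLp.2 ^ 2 * ‖h‖ ^ 2 := by
      rw [norm_add_sq_real, real_inner_smul_left, real_inner_smul_right, hgh, norm_smul,
        norm_smul, mul_pow, mul_pow, Real.norm_eq_abs, Real.norm_eq_abs, sq_abs, sq_abs]
      ring
    have h3 : ((‖t.ofLp.1 • g + t.ofLp.2 • h‖ : ℝ) : ℂ) ^ 2
        = (t.ofLp.1 : ℂ) ^ 2 * (‖g‖ : ℂ) ^ 2 + (t.ofLp.2 : ℂ) ^ 2 * (‖h‖ : ℂ) ^ 2 := by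
      exact_mod_cast h2
    rw [h3] at h1
    calc _ = ∫ ω, Complex.exp (Complex.I * W (t.ofLp.1 • g + t.ofLp.2 • h) ω) ∂P := by
          refine integral_congr_ae ?_
          filter_upwards [hW.linear_ae t.ofLp.1 t.ofLp.2 g h] with ω hω
          rw [hω, mul_comm]
          congr 2
      _ = _ := by
          rw [h1]
          congr 1
          simp
          ring
  · exact (WithLp.prod_continuous_toLp 2 ℝ ℝ).measurable.comp_aemeasurable
      ((hW.aemeasurable g).prodMk (hW.aemeasurable h))
  · fun_prop

/-- The characteristic function of an isonormal process after an exponential change of measure. -/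
lemma integral_cexp_mul_exp [IsProbabilityMeasure P] (hW : IsIsonormal P W) (g h : H) :
    ∫ ω, Complex.exp (W g ω * Complex.I) * Real.exp (W h ω - ‖h‖ ^ 2 / 2) ∂P
      = Complex.exp (inner ℝ g h * Complex.I - (‖g‖ : ℂ) ^ 2 / 2) := by
  -- Project `g` onto `h`: the remainder `p` is orthogonal to `h`, so `W p` is independent of the
  -- density and the integral splits into two one-dimensional Gaussian ones.
  obtain ⟨c, hc⟩ : ∃ c : ℝ, inner ℝ (g - c • h) h = 0 := by
    by_cases hh : h = 0
    · exact ⟨0, by simp [hh]⟩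
    · refine ⟨inner ℝ g h / ‖h‖ ^ 2, ?_⟩
      have : ‖h‖ ≠ 0 := by simpa using hh
      rw [inner_sub_left, real_inner_smul_left, real_inner_self_eq_norm_sq]
      field_simp
      ring
  set p := g - c • h with hp
  have hg : g = (1 : ℝ) • p + c • h := by simp [hp]
  have hgh : inner ℝ g h = c * ‖h‖ ^ 2 := by
    rw [hg, inner_add_left, real_inner_smul_left, real_inner_smul_left, hc,
      real_inner_self_eq_norm_sq]
    ring
  have hgg : ‖g‖ ^ 2 = ‖p‖ ^ 2 + c ^ 2 * ‖h‖ ^ 2 := by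
    rw [hg, norm_add_sq_real, real_inner_smul_right, real_inner_smul_left, hc, norm_smul,
      norm_smul, mul_pow, mul_pow, Real.norm_eq_abs, Real.norm_eq_abs, sq_abs, sq_abs]
    ring
  have hgg' : (‖g‖ : ℂ) ^ 2 = (‖p‖ : ℂ) ^ 2 + (c : ℂ) ^ 2 * (‖h‖ : ℂ) ^ 2 := by
    exact_mod_cast hgg
  have hind := hW.indepFun hc
  have hind' : IndepFun (fun ω => Complex.exp (Complex.I * W p ω))
      (fun ω => Complex.exp ((c * Complex.I + 1) * W h ω)) P :=
    hind.comp (φ := fun x : ℝ => Complex.exp (Complex.I * x))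
      (ψ := fun x : ℝ => Complex.exp ((c * Complex.I + 1) * x)) (by fun_prop) (by fun_prop)
  have m1 := hW.aemeasurable p
  have m2 := hW.aemeasurable h
  have key := hind'.integral_fun_mul_eq_mul_integral
    (by fun_prop : AEMeasurable _ P).aestronglyMeasurable
    (by fun_prop : AEMeasurable _ P).aestronglyMeasurable
  rw [hW.integral_cexp, hW.integral_cexp] at key
  calc _ = ∫ ω, Complex.exp (-(‖h‖ : ℂ) ^ 2 / 2) * (Complex.exp (Complex.I * W p ω)
        * Complex.exp ((c * Complex.I + 1) * W h ω)) ∂P := by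
        refine integral_congr_ae ?_
        have := hW.linear_ae 1 c p h
        rw [← hg] at this
        filter_upwards [this] with ω hω
        rw [hω, Complex.ofReal_exp, ← Complex.exp_add, ← Complex.exp_add, ← Complex.exp_add]
        congr 1
        push_cast
        ring
    _ = _ := by
        rw [integral_const_mul, key, ← Complex.exp_add, ← Complex.exp_add, hgg', hgh]
        congr 1
        push_cast
        linear_combination (1 / 2 * (‖p‖ : ℂ) ^ 2 + 1 / 2 * (‖h‖ : ℂ) ^ 2 * (c : ℂ) ^ 2)
          * Complex.I_sq

end IsIsonormal

end Isonormal

end InverseDetection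

namespace InverseDetection

/-! ### Conjugated coordinates and the Cameron–Martin formula for the data -/

section ConjCoord

variable {𝕜 Y ι : Type*} [RCLike 𝕜] [NormedAddCommGroup Y] [InnerProductSpace 𝕜 Y]

/-- Conjugation of the coordinates with respect to a Hilbert basis. -/
noncomputable def conjCoord (e : HilbertBasis ι 𝕜 Y) (h : Y) : Y := e.repr.symm (star (e.repr h))

lemma conjCoord_add (e : HilbertBasis ι 𝕜 Y) (g h : Y) :
    conjCoord e (g + h) = conjCoord e g + conjCoord e h := by
  simp [conjCoord]

/-- The noise `ξ` is linear in `h`, whereas the signal `inner 𝕜 h (A f)` is antilinear. Composing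
`ξ` with this antilinear isometry, which fixes the basis, makes both transform alike without
changing the data or the noise laws. -/
lemma conjCoord_smul (e : HilbertBasis ι 𝕜 Y) (c : 𝕜) (h : Y) :
    conjCoord e (c • h) = conj c • conjCoord e h := by
  simp [conjCoord, star_smul]

lemma norm_conjCoord (e : HilbertBasis ι 𝕜 Y) (h : Y) : ‖conjCoord e h‖ = ‖h‖ := by
  simp [conjCoord, norm_star]

lemma conjCoord_self (e : HilbertBasis ι 𝕜 Y) (i : ι) : conjCoord e (e i) = e i := by
  classical
  have : star (e.repr (e i)) = e.repr (e i) := by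
    ext j
    rw [lp.star_apply, e.repr_apply_apply, orthonormal_iff_ite.1 e.orthonormal j i]
    split_ifs <;> simp
  rw [conjCoord, this, LinearIsometryEquiv.symm_apply_apply]

lemma conjCoord_sum (e : HilbertBasis ι 𝕜 Y) (s : Finset ι) (c : ι → 𝕜) :
    conjCoord e (∑ i ∈ s, c i • e i) = ∑ i ∈ s, conj (c i) • e i := by
  classical
  induction s using Finset.induction_on with
  | empty => simp [conjCoord]
  | insert a s ha ih =>
    rw [Finset.sum_insert ha, Finset.sum_insert ha, conjCoord_add, ih, conjCoord_smul,
      conjCoord_self]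

end ConjCoord

section Model

variable {𝕜 X Y Ω ι I : Type*} [RCLike 𝕜]
  [NormedAddCommGroup X] [InnerProductSpace 𝕜 X]
  [NormedAddCommGroup Y] [InnerProductSpace 𝕜 Y]
  [MeasurableSpace Ω] {P : Measure Ω}

/-- The real part of the white noise, in the antilinear convention matching the signal. -/
noncomputable def realNoise (ξ : Y →ₗ[𝕜] Lp 𝕜 2 P) (e : HilbertBasis ι 𝕜 Y) (h : Y) (ω : Ω) : ℝ :=
  RCLike.re (ξ (conjCoord e h) ω)

lemma aemeasurable_noise (ξ : Y →ₗ[𝕜] Lp 𝕜 2 P) (h : Y) : AEMeasurable (fun ω => ξ h ω) P :=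
  (Lp.aestronglyMeasurable (ξ h)).aemeasurable

lemma map_re_noiseLaw (v : ℝ≥0) : (noiseLaw 𝕜 v).map RCLike.re = gaussianReal 0 v := by
  rw [noiseLaw, Measure.map_map RCLike.measurable_re (by fun_prop)]
  have : (RCLike.re ∘ fun p : ℝ × ℝ => (p.1 : 𝕜) + (p.2 : 𝕜) * (RCLike.I : 𝕜)) = Prod.fst := by
    ext p
    simp
  rw [this, Measure.map_fst_prod]
  simp

/-- Treats both scalar fields at once: `Y` is regarded as a real Hilbert space with inner product
`Re ⟨·,·⟩`, the quantity that also enters `maxNonnegCorrelated`. -/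
lemma isIsonormal_realNoise {ξ : Y →ₗ[𝕜] Lp 𝕜 2 P} (hξ : IsGaussianWhiteNoise P ξ)
    (e : HilbertBasis ι 𝕜 Y) :
    letI := InnerProductSpace.rclikeToReal 𝕜 Y
    IsIsonormal P (realNoise ξ e) := by
  let := InnerProductSpace.rclikeToReal 𝕜 Y
  constructor
  · exact fun h => RCLike.measurable_re.comp_aemeasurable (aemeasurable_noise ξ _)
  · intro h
    have := AEMeasurable.map_map_of_aemeasurable (μ := P) (g := (RCLike.re : 𝕜 → ℝ))
      RCLike.measurable_re.aemeasurable (aemeasurable_noise ξ (conjCoord e h))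
    rw [hξ.law_eq, map_re_noiseLaw] at this
    have hn : ‖conjCoord e h‖₊ = ‖h‖₊ := NNReal.eq (norm_conjCoord e h)
    rw [hn] at this
    exact this.symm
  · intro g h
    filter_upwards [Lp.coeFn_add (ξ (conjCoord e g)) (ξ (conjCoord e h))] with ω hω
    simp only [realNoise]
    rw [conjCoord_add, map_add, hω]
    simp
  · intro c h
    filter_upwards [Lp.coeFn_smul (c : 𝕜) (ξ (conjCoord e h))] with ω hω
    have : c • h = (c : 𝕜) • h := rfl
    simp only [realNoise]
    rw [this, conjCoord_smul, RCLike.conj_ofReal, map_smul, hω]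
    simp

lemma realNoise_smul_basis (ξ : Y →ₗ[𝕜] Lp 𝕜 2 P) (e : HilbertBasis ι 𝕜 Y) (c : 𝕜) (i : ι) :
    realNoise ξ e (c • e i) =ᵐ[P] fun ω => RCLike.re (conj c * ξ (e i) ω) := by
  filter_upwards [Lp.coeFn_smul (conj c) (ξ (e i))] with ω hω
  simp only [realNoise]
  rw [conjCoord_smul, conjCoord_self, map_smul, hω]
  simp

lemma aemeasurable_observation (A : X →L[𝕜] Y) (ξ : Y →ₗ[𝕜] Lp 𝕜 2 P) (σ : ℝ) (f : X) (h : Y) :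
    AEMeasurable (observation A ξ σ f h) P := by
  have := aemeasurable_noise ξ h
  unfold observation
  fun_prop

lemma aemeasurable_data [Countable ι] (A : X →L[𝕜] Y) (ξ : Y →ₗ[𝕜] Lp 𝕜 2 P)
    (e : HilbertBasis ι 𝕜 Y) (σ : ℝ) (f : X) :
    AEMeasurable (fun ω i => observation A ξ σ f (e i) ω) P :=
  aemeasurable_pi_lambda _ fun i => aemeasurable_observation A ξ σ f (e i)

/-- Every real functional of finitely many scalars is the real part of an inner product. -/
lemma exists_eq_sum_re_conj_mul {κ : Type*} [Fintype κ] (L : (κ → 𝕜) →L[ℝ] ℝ) :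
    ∃ t : κ → 𝕜, ∀ y, L y = ∑ i, RCLike.re (conj (t i) * y i) := by
  classical
  refine ⟨fun i => (InnerProductSpace.toDual ℝ 𝕜).symm
    (L.comp (ContinuousLinearMap.single ℝ (fun _ : κ => 𝕜) i)), fun y => ?_⟩
  have h1 : ∀ i, RCLike.re (conj ((InnerProductSpace.toDual ℝ 𝕜).symm
      (L.comp (ContinuousLinearMap.single ℝ (fun _ : κ => 𝕜) i))) * y i)
      = L (Pi.single i (y i)) := by
    intro i
    have := InnerProductSpace.toDual_symm_apply (𝕜 := ℝ) (x := y i)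
      (y := L.comp (ContinuousLinearMap.single ℝ (fun _ : κ => 𝕜) i))
    rw [mul_comm]
    exact this
  simp_rw [h1]
  rw [← map_sum, Finset.univ_sum_single]

/-- The density of the data law with signal `f` with respect to the one without signal. -/
noncomputable def likelihood (ξ : Y →ₗ[𝕜] Lp 𝕜 2 P) (e : HilbertBasis ι 𝕜 Y) (h : Y) (ω : Ω) : ℝ :=
  Real.exp (realNoise ξ e h ω - ‖h‖ ^ 2 / 2)

lemma integrable_likelihood {ξ : Y →ₗ[𝕜] Lp 𝕜 2 P} (hξ : IsGaussianWhiteNoise P ξ)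
    (e : HilbertBasis ι 𝕜 Y) (h : Y) : Integrable (likelihood ξ e h) P := by
  let := InnerProductSpace.rclikeToReal 𝕜 Y
  have := ((isIsonormal_realNoise hξ e).integrable_exp h 1).mul_const (Real.exp (-(‖h‖ ^ 2 / 2)))
  refine this.congr (ae_of_all _ fun ω => ?_)
  simp only [likelihood]
  rw [← Real.exp_add, one_mul, sub_eq_add_neg]

/-- Cameron–Martin theorem for the sequence model. -/
theorem dataLaw_eq_map_withDensity [IsProbabilityMeasure P] [Countable ι] (A : X →L[𝕜] Y)
    {ξ : Y →ₗ[𝕜] Lp 𝕜 2 P} (hξ : IsGaussianWhiteNoise P ξ) (e : HilbertBasis ι 𝕜 Y)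
    {σ : ℝ} (hσ : σ ≠ 0) (f : X) :
    dataLaw A ξ e σ f =
      (P.withDensity fun ω => ENNReal.ofReal (likelihood ξ e (((σ⁻¹ : ℝ) : 𝕜) • A f) ω)).map
        (fun ω i => observation A ξ σ 0 (e i) ω) := by
  let := InnerProductSpace.rclikeToReal 𝕜 Y
  have hW := isIsonormal_realNoise hξ e
  set h : Y := ((σ⁻¹ : ℝ) : 𝕜) • A f with hh
  have hLint := integrable_likelihood hξ e h
  set Q := P.withDensity fun ω => ENNReal.ofReal (likelihood ξ e h ω) with hQ
  have : IsFiniteMeasure Q := isFiniteMeasure_withDensity_ofReal hLint.2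
  have hQP : Q ≪ P := withDensity_absolutelyContinuous _ _
  have hm0 := aemeasurable_data A ξ e σ 0
  have hmQ := hm0.mono_ac hQP
  -- Finite measures on the product are determined by their finite-dimensional marginals, and these
  -- by their characteristic functions.
  refine IsProjectiveLimit.unique (isProjectiveLimit_map (aemeasurable_data A ξ e σ f)) ?_
  convert! isProjectiveLimit_map hmQ using 1
  ext1 s
  have hms : ∀ f', AEMeasurable (fun ω => s.restrict fun i => observation A ξ σ f' (e i) ω) P :=
    fun f' => (Finset.measurable_restrict s).comp_aemeasurable (aemeasurable_data A ξ e σ f')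
  refine Measure.ext_of_charFunDual ?_
  ext L
  obtain ⟨t, ht⟩ := exists_eq_sum_re_conj_mul L
  set g : Y := ∑ i : s, t i • e i with hg
  -- A real functional of finitely many data is a deterministic shift plus the isonormal process at
  -- `σ • g`; both characteristic functions thereby become integrals computed earlier.
  have hLf : ∀ f', ∀ᵐ ω ∂P, L (s.restrict fun i => observation A ξ σ f' (e i) ω)
      = RCLike.re (inner 𝕜 g (A f')) + realNoise ξ e (σ • g) ω := by
    intro f'
    have h1 : ∀ᵐ ω ∂P, ∀ i : s, realNoise ξ e (t i • e i) ω
        = RCLike.re (conj (t i) * ξ (e i) ω) :=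
      ae_all_iff.2 fun i => realNoise_smul_basis ξ e (t i) i
    filter_upwards [h1, hW.smul_ae σ g, hW.sum_ae Finset.univ fun i : s => t i • e i]
      with ω h1 h2 h3
    rw [h2, hg, h3, ht, sum_inner, map_sum, Finset.mul_sum, ← Finset.sum_add_distrib]
    refine Finset.sum_congr rfl fun i _ => ?_
    rw [h1, inner_smul_left, Finset.restrict, observation, mul_add, map_add]
    congr 1
    rw [← RCLike.re_ofReal_mul]
    congr 1
    ring
  rw [charFunDual_apply, charFunDual_apply, integral_map (hms f) (by fun_prop),
    integral_map ((hms 0).mono_ac hQP) (by fun_prop), hQ,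
    integral_withDensity_eq_integral_toReal_smul₀ (by
      exact hLint.aemeasurable.ennreal_ofReal) (by simp)]
  calc _ = ∫ ω, Complex.exp ((RCLike.re (inner 𝕜 g (A f)) : ℝ) * Complex.I)
        * Complex.exp (Complex.I * realNoise ξ e (σ • g) ω) ∂P := by
        refine integral_congr_ae ?_
        filter_upwards [hLf f] with ω hω
        rw [hω, ← Complex.exp_add]
        congr 1
        push_cast
        ring
    _ = Complex.exp (inner ℝ (σ • g) h * Complex.I - (‖σ • g‖ : ℂ) ^ 2 / 2) := by
        rw [integral_const_mul, hW.integral_cexp, ← Complex.exp_add]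
        have h2 : inner ℝ (σ • g) h = RCLike.re (inner 𝕜 g (A f)) := by
          have : inner ℝ (σ • g) h = RCLike.re (inner 𝕜 ((σ : 𝕜) • g) h) := rfl
          rw [this, hh, inner_smul_left, inner_smul_right, RCLike.conj_ofReal, ← mul_assoc,
            ← RCLike.ofReal_mul, mul_inv_cancel₀ hσ]
          simp
        rw [h2, Complex.I_sq]
        congr 1
        ring
    _ = _ := by
        rw [← hW.integral_cexp_mul_exp]
        refine integral_congr_ae ?_
        filter_upwards [hLf 0] with ω hω
        rw [hω, likelihood, ENNReal.toReal_ofReal (Real.exp_nonneg _), map_zero, inner_zero_right,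
          map_zero, zero_add, Complex.real_smul, mul_comm]

end Model

end InverseDetection

namespace InverseDetection

/-! ### Truncated likelihood ratios and their second moments -/

section TruncLikelihood

variable {Ω H : Type*}

/-- The likelihood ratio for the shift by `a` in direction `v`, truncated at level `τ`. -/
noncomputable def truncLikelihood (W : H → Ω → ℝ) (a τ : ℝ) (v : H) (ω : Ω) : ℝ :=
  if W v ω ≤ τ then Real.exp (a * W v ω - a ^ 2 / 2) else 0

lemma truncLikelihood_nonneg (W : H → Ω → ℝ) (a τ : ℝ) (v : H) (ω : Ω) :
    0 ≤ truncLikelihood W a τ v ω := by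
  unfold truncLikelihood
  split_ifs <;> positivity

lemma truncLikelihood_le (W : H → Ω → ℝ) (a τ : ℝ) (v : H) (ω : Ω) :
    truncLikelihood W a τ v ω ≤ Real.exp (a * W v ω - a ^ 2 / 2) := by
  unfold truncLikelihood
  split_ifs <;> first | exact le_rfl | positivity

lemma truncLikelihood_le_const (W : H → Ω → ℝ) {a : ℝ} (ha : 0 ≤ a) (τ : ℝ) (v : H) (ω : Ω) :
    truncLikelihood W a τ v ω ≤ Real.exp (a * τ) := by
  unfold truncLikelihood
  split_ifs with h
  · have := mul_le_mul_of_nonneg_left h ha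
    gcongr
    nlinarith
  · positivity

end TruncLikelihood

section TruncatedSecondMoment

variable {Ω H I : Type*} [MeasurableSpace Ω] [NormedAddCommGroup H] [InnerProductSpace ℝ H]
  {P : Measure Ω} {W : H → Ω → ℝ}

namespace IsIsonormal

lemma aemeasurable_truncLikelihood (hW : IsIsonormal P W) (a τ : ℝ) (v : H) :
    AEMeasurable (truncLikelihood W a τ v) P := by
  have h1 : Measurable fun x : ℝ => if x ≤ τ then Real.exp (a * x - a ^ 2 / 2) else 0 :=
    Measurable.ite measurableSet_Iic (by fun_prop) measurable_const
  exact h1.comp_aemeasurable (hW.aemeasurable v)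

lemma integrable_truncLikelihood [IsProbabilityMeasure P] (hW : IsIsonormal P W) {a : ℝ}
    (ha : 0 ≤ a) (τ : ℝ) (v : H) : Integrable (truncLikelihood W a τ v) P :=
  Integrable.of_bound (hW.aemeasurable_truncLikelihood a τ v).aestronglyMeasurable
    (Real.exp (a * τ)) (ae_of_all _ fun ω => by
      rw [Real.norm_of_nonneg (truncLikelihood_nonneg W a τ v ω)]
      exact truncLikelihood_le_const W ha τ v ω)

lemma integrable_truncLikelihood_mul [IsProbabilityMeasure P] (hW : IsIsonormal P W) {a : ℝ}
    (ha : 0 ≤ a) (τ : ℝ) (v w : H) :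
    Integrable (fun ω => truncLikelihood W a τ v ω * truncLikelihood W a τ w ω) P :=
  (hW.integrable_truncLikelihood ha τ v).mul_bdd (c := Real.exp (a * τ))
    (hW.aemeasurable_truncLikelihood a τ w).aestronglyMeasurable (ae_of_all _ fun ω => by
      rw [Real.norm_of_nonneg (truncLikelihood_nonneg W a τ w ω)]
      exact truncLikelihood_le_const W ha τ w ω)

lemma integrable_exp_sub (hW : IsIsonormal P W) (h : H) (t c : ℝ) :
    Integrable (fun ω => Real.exp (t * W h ω - c)) P := by
  simp_rw [Real.exp_sub]
  exact (hW.integrable_exp h t).div_const _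

lemma integral_exp_sub (hW : IsIsonormal P W) (h : H) (t c : ℝ) :
    ∫ ω, Real.exp (t * W h ω - c) ∂P = Real.exp (‖h‖ ^ 2 * t ^ 2 / 2 - c) := by
  simp_rw [Real.exp_sub]
  rw [integral_div, hW.mgf_eq]

/-- The untruncated ratio has mean `1`. Where `W v > a + s`, it is at most its product with `exp (s
(W v - (a + s)))`, whose mean is `exp (-s² / 2)`: a Chernoff bound. -/
lemma le_integral_truncLikelihood [IsProbabilityMeasure P] (hW : IsIsonormal P W) {a s : ℝ}
    (ha : 0 ≤ a) (hs : 0 ≤ s) {v : H} (hv : ‖v‖ = 1) :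
    1 - Real.exp (-s ^ 2 / 2) ≤ ∫ ω, truncLikelihood W a (a + s) v ω ∂P := by
  have h1 : ∀ ω, Real.exp (a * W v ω - a ^ 2 / 2)
      - Real.exp ((a + s) * W v ω - (a ^ 2 / 2 + s * (a + s)))
      ≤ truncLikelihood W a (a + s) v ω := by
    intro ω
    unfold truncLikelihood
    split_ifs with h
    · linarith [Real.exp_pos ((a + s) * W v ω - (a ^ 2 / 2 + s * (a + s)))]
    · rw [sub_nonpos, Real.exp_le_exp]
      nlinarith
  have h2 := integral_mono ((hW.integrable_exp_sub v a _).sub (hW.integrable_exp_sub v (a + s) _))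
    (hW.integrable_truncLikelihood ha (a + s) v) h1
  rw [integral_sub' (hW.integrable_exp_sub v a _) (hW.integrable_exp_sub v (a + s) _),
    hW.integral_exp_sub, hW.integral_exp_sub, hv] at h2
  have e1 : (1 : ℝ) ^ 2 * a ^ 2 / 2 - a ^ 2 / 2 = 0 := by ring
  have e2 : (1 : ℝ) ^ 2 * (a + s) ^ 2 / 2 - (a ^ 2 / 2 + s * (a + s)) = -s ^ 2 / 2 := by ring
  rwa [e1, e2, Real.exp_zero] at h2

/-- Truncation is not needed here: the product of the full ratios has mean `exp (a² ⟨v, w⟩)`. -/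
lemma integral_truncLikelihood_mul_le_one [IsProbabilityMeasure P] (hW : IsIsonormal P W) {a : ℝ}
    (ha : 0 ≤ a) (τ : ℝ) {v w : H} (hv : ‖v‖ = 1) (hw : ‖w‖ = 1) (hvw : inner ℝ v w ≤ 0) :
    ∫ ω, truncLikelihood W a τ v ω * truncLikelihood W a τ w ω ∂P ≤ 1 := by
  calc _ ≤ ∫ ω, Real.exp (a * W (v + w) ω - a ^ 2) ∂P := by
        refine integral_mono_ae (hW.integrable_truncLikelihood_mul ha τ v w)
          (hW.integrable_exp_sub _ _ _) ?_
        filter_upwards [hW.add_ae v w] with ω hω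
        rw [hω]
        calc _ ≤ Real.exp (a * W v ω - a ^ 2 / 2) * Real.exp (a * W w ω - a ^ 2 / 2) :=
              mul_le_mul (truncLikelihood_le ..) (truncLikelihood_le ..)
                (truncLikelihood_nonneg ..) (Real.exp_nonneg _)
          _ = _ := by
              rw [← Real.exp_add]
              congr 1
              ring
    _ ≤ 1 := by
        rw [hW.integral_exp_sub, norm_add_sq_real, hv, hw, Real.exp_le_one_iff]
        nlinarith [sq_nonneg a]

/-- Where `W v ≤ τ`, the condition `τ ≤ 2 a` gives `2 a W v ≤ τ W v + (2 a - τ) τ`. The tilt thus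
drops from `2 a` to `τ`, and the mean of `exp (τ W v)` is explicit. -/
lemma integral_truncLikelihood_sq_le [IsProbabilityMeasure P] (hW : IsIsonormal P W) {a τ : ℝ}
    (ha : 0 ≤ a) (hτ : τ ≤ 2 * a) {v : H} (hv : ‖v‖ = 1) :
    ∫ ω, truncLikelihood W a τ v ω ^ 2 ∂P ≤ Real.exp (τ ^ 2 / 2 - (τ - a) ^ 2) := by
  have hint : Integrable (fun ω => truncLikelihood W a τ v ω ^ 2) P := by
    simpa only [sq] using hW.integrable_truncLikelihood_mul ha τ v v
  calc _ ≤ ∫ ω, Real.exp (τ * W v ω - (a ^ 2 - (2 * a - τ) * τ)) ∂P := by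
        refine integral_mono hint (hW.integrable_exp_sub _ _ _) fun ω => ?_
        unfold truncLikelihood
        beta_reduce
        split_ifs with h
        · rw [← Real.exp_nat_mul, Real.exp_le_exp]
          push_cast
          nlinarith
        · simp [Real.exp_nonneg]
    _ = _ := by
        rw [hW.integral_exp_sub, hv]
        congr 1
        ring

lemma integral_truncLikelihood_mul_le [IsProbabilityMeasure P] (hW : IsIsonormal P W) {a τ : ℝ}
    (ha : 0 ≤ a) (hτ : τ ≤ 2 * a) {v w : H} (hv : ‖v‖ = 1) (hw : ‖w‖ = 1) :
    ∫ ω, truncLikelihood W a τ v ω * truncLikelihood W a τ w ω ∂P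
      ≤ Real.exp (τ ^ 2 / 2 - (τ - a) ^ 2) := by
  have hint : ∀ v, Integrable (fun ω => truncLikelihood W a τ v ω ^ 2 / 2) P := fun v => by
    simpa only [sq] using (hW.integrable_truncLikelihood_mul ha τ v v).div_const 2
  calc _ ≤ ∫ ω, (truncLikelihood W a τ v ω ^ 2 / 2 + truncLikelihood W a τ w ω ^ 2 / 2) ∂P := by
        refine integral_mono (hW.integrable_truncLikelihood_mul ha τ v w)
          ((hint v).add (hint w)) fun ω => ?_
        nlinarith [sq_nonneg (truncLikelihood W a τ v ω - truncLikelihood W a τ w ω)]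
    _ ≤ _ := by
        rw [integral_add (hint v) (hint w), integral_div, integral_div]
        linarith [hW.integral_truncLikelihood_sq_le ha hτ hv,
          hW.integral_truncLikelihood_sq_le ha hτ hw]

open Classical in
/-- The truncated second moment bound for the average likelihood ratio. -/
lemma integral_one_sub_average_sq_le [IsProbabilityMeasure P] (hW : IsIsonormal P W)
    {J : Finset I} {v : I → H} (hJ : J.Nonempty) (hv : ∀ k ∈ J, ‖v k‖ = 1) {M : ℕ}
    (hM : ∀ k ∈ J, (J.filter fun k' => 0 ≤ inner ℝ (v k) (v k')).card ≤ M)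
    {a s : ℝ} (hs : 0 ≤ s) (hsa : s ≤ a) (has : a + s = √(2 * Real.log J.card)) :
    ∫ ω, (1 - (J.card : ℝ)⁻¹ * ∑ k ∈ J, truncLikelihood W a (a + s) (v k) ω) ^ 2 ∂P
      ≤ 2 * Real.exp (-s ^ 2 / 2) + M * Real.exp (-s ^ 2) := by
  have ha : 0 ≤ a := hs.trans hsa
  have hN : (0 : ℝ) < J.card := by exact_mod_cast hJ.card_pos
  set N : ℝ := (J.card : ℝ) with hNdef
  set g : I → Ω → ℝ := fun k => truncLikelihood W a (a + s) (v k) with hg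
  have hgint : ∀ k, Integrable (g k) P := fun k => hW.integrable_truncLikelihood ha _ _
  have hggint : ∀ k k', Integrable (fun ω => g k ω * g k' ω) P :=
    fun k k' => hW.integrable_truncLikelihood_mul ha _ _ _
  -- The truncation level `√(2 log N)` is chosen so that the pair bound is of order `N`; one factor
  -- `N⁻¹` of the averaging then absorbs it.
  have hlog : Real.exp ((a + s) ^ 2 / 2 - (a + s - a) ^ 2) = N * Real.exp (-s ^ 2) := by
    have h0 : 0 ≤ Real.log N := Real.log_natCast_nonneg _
    rw [has, Real.sq_sqrt (by positivity), ← has]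
    have : 2 * Real.log N / 2 - (a + s - a) ^ 2 = Real.log N + -s ^ 2 := by ring
    rw [this, Real.exp_add, Real.exp_log hN]
  have hmean : 1 - Real.exp (-s ^ 2 / 2) ≤ N⁻¹ * ∑ k ∈ J, ∫ ω, g k ω ∂P := by
    have h1 : ∑ _k ∈ J, (1 - Real.exp (-s ^ 2 / 2)) ≤ ∑ k ∈ J, ∫ ω, g k ω ∂P :=
      Finset.sum_le_sum fun k hk => hW.le_integral_truncLikelihood ha hs (hv k hk)
    rw [Finset.sum_const, nsmul_eq_mul, ← hNdef] at h1
    rw [inv_mul_eq_div, le_div_iff₀ hN]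
    linarith
  have hpair : ∑ k ∈ J, ∑ k' ∈ J, ∫ ω, g k ω * g k' ω ∂P
      ≤ N * (N + M * (N * Real.exp (-s ^ 2))) := by
    have h1 : ∀ k ∈ J, ∑ k' ∈ J, ∫ ω, g k ω * g k' ω ∂P
        ≤ N + M * (N * Real.exp (-s ^ 2)) := by
      intro k hk
      -- The `1` serves the negatively correlated pairs; the large term occurs for at most `M`
      -- indices `k'`.
      calc _ ≤ ∑ k' ∈ J, (1 + if 0 ≤ inner ℝ (v k) (v k') then N * Real.exp (-s ^ 2) else 0) := by
            refine Finset.sum_le_sum fun k' hk' => ?_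
            split_ifs with h
            · have := hW.integral_truncLikelihood_mul_le ha (by linarith : a + s ≤ 2 * a)
                (hv k hk) (hv k' hk')
              rw [hlog] at this
              linarith
            · rw [add_zero]
              exact hW.integral_truncLikelihood_mul_le_one ha _ (hv k hk) (hv k' hk')
                (not_le.1 h).le
        _ ≤ _ := by
            rw [Finset.sum_add_distrib, ← Finset.sum_filter, Finset.sum_const, Finset.sum_const,
              nsmul_eq_mul, nsmul_eq_mul, mul_one, ← hNdef]
            gcongr
            exact hM k hk
    calc _ ≤ ∑ _k ∈ J, (N + M * (N * Real.exp (-s ^ 2))) := Finset.sum_le_sum h1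
      _ = _ := by rw [Finset.sum_const, nsmul_eq_mul, ← hNdef]
  have hexp : ∀ ω, (1 - N⁻¹ * ∑ k ∈ J, g k ω) ^ 2
      = 1 - 2 * (N⁻¹ * ∑ k ∈ J, g k ω) + N⁻¹ ^ 2 * ∑ k ∈ J, ∑ k' ∈ J, g k ω * g k' ω := by
    intro ω
    rw [← Finset.sum_mul_sum]
    ring
  have i1 : Integrable (fun ω => 2 * (N⁻¹ * ∑ k ∈ J, g k ω)) P :=
    ((integrable_finsetSum _ fun k _ => hgint k).const_mul _).const_mul _
  have i2 : Integrable (fun ω => N⁻¹ ^ 2 * ∑ k ∈ J, ∑ k' ∈ J, g k ω * g k' ω) P :=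
    (integrable_finsetSum _ fun k _ => integrable_finsetSum _ fun k' _ => hggint k k').const_mul _
  have i0 : Integrable (fun _ : Ω => (1 : ℝ)) P := integrable_const _
  have hcalc : ∫ ω, (1 - N⁻¹ * ∑ k ∈ J, g k ω) ^ 2 ∂P = 1 - 2 * (N⁻¹ * ∑ k ∈ J, ∫ ω, g k ω ∂P)
      + N⁻¹ ^ 2 * ∑ k ∈ J, ∑ k' ∈ J, ∫ ω, g k ω * g k' ω ∂P := by
    simp_rw [hexp]
    have i3 : Integrable (fun ω => 1 - 2 * (N⁻¹ * ∑ k ∈ J, g k ω)) P := i0.sub i1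
    rw [integral_add i3 i2, integral_sub i0 i1, integral_const_mul, integral_const_mul,
      integral_const_mul, integral_finsetSum _ fun k _ => hgint k,
      integral_finsetSum _ fun k _ => integrable_finsetSum _ fun k' _ => hggint k k']
    simp_rw [integral_finsetSum J fun k' _ => hggint _ k']
    simp
  have hpair' : N⁻¹ ^ 2 * ∑ k ∈ J, ∑ k' ∈ J, ∫ ω, g k ω * g k' ω ∂P
      ≤ 1 + M * Real.exp (-s ^ 2) := by
    calc _ ≤ N⁻¹ ^ 2 * (N * (N + M * (N * Real.exp (-s ^ 2)))) := by gcongr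
      _ = _ := by field_simp
  rw [hcalc]
  linarith

open Classical in
/-- Lower bound for the sum of the error probabilities of a single test with acceptance
region `B`. -/
lemma one_sub_sqrt_le_error [IsProbabilityMeasure P] (hW : IsIsonormal P W)
    {J : Finset I} {v : I → H} (hJ : J.Nonempty) (hv : ∀ k ∈ J, ‖v k‖ = 1) {M : ℕ}
    (hM : ∀ k ∈ J, (J.filter fun k' => 0 ≤ inner ℝ (v k) (v k')).card ≤ M)
    {a s : ℝ} (hs : 0 ≤ s) (hsa : s ≤ a) (has : a + s = √(2 * Real.log J.card))
    {B : Set Ω} (hB : NullMeasurableSet B P) :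
    1 - √(2 * Real.exp (-s ^ 2 / 2) + M * Real.exp (-s ^ 2))
      ≤ P.real Bᶜ + (J.card : ℝ)⁻¹ *
        ∑ k ∈ J, ∫ ω in B, Real.exp (a * W (v k) ω - a ^ 2 / 2) ∂P := by
  have ha : 0 ≤ a := hs.trans hsa
  have hN : (0 : ℝ) < J.card := by exact_mod_cast hJ.card_pos
  have hbound := hW.integral_one_sub_average_sq_le hJ hv hM hs hsa has
  set D := 2 * Real.exp (-s ^ 2 / 2) + M * Real.exp (-s ^ 2) with hD
  set c := √D with hc
  have hDpos : 0 < D := by positivity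
  have hcpos : 0 < c := Real.sqrt_pos.2 hDpos
  have hcD : c ^ 2 = D := Real.sq_sqrt hDpos.le
  set G : Ω → ℝ := fun ω => (J.card : ℝ)⁻¹ * ∑ k ∈ J, truncLikelihood W a (a + s) (v k) ω with hG
  have hGint : Integrable G P :=
    (integrable_finsetSum _ fun k _ => hW.integrable_truncLikelihood ha _ _).const_mul _
  have hGmeas : AEMeasurable G P := hGint.aemeasurable
  have hGnn : ∀ ω, 0 ≤ G ω := fun ω =>
    mul_nonneg (by positivity) (Finset.sum_nonneg fun k _ => truncLikelihood_nonneg ..)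
  have hGle : ∀ ω, G ω ≤ Real.exp (a * (a + s)) := by
    intro ω
    have : ∑ k ∈ J, truncLikelihood W a (a + s) (v k) ω ≤ ∑ _k ∈ J, Real.exp (a * (a + s)) :=
      Finset.sum_le_sum fun k _ => truncLikelihood_le_const W ha _ _ _
    rw [Finset.sum_const, nsmul_eq_mul] at this
    rw [hG]
    beta_reduce
    rw [inv_mul_eq_div, div_le_iff₀ hN]
    linarith
  have hsqint : Integrable (fun ω => (1 - G ω) ^ 2) P := by
    refine Integrable.of_bound (by fun_prop : AEMeasurable _ P).aestronglyMeasurable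
      ((1 + Real.exp (a * (a + s))) ^ 2) (ae_of_all _ fun ω => ?_)
    rw [Real.norm_of_nonneg (sq_nonneg _)]
    have h1 := hGnn ω
    have h2 := hGle ω
    apply sq_le_sq'
    · linarith
    · linarith [Real.exp_pos (a * (a + s))]
  have hquad : Integrable (fun ω => ((1 - G ω) ^ 2 / c + c) / 2) P :=
    ((hsqint.div_const c).add (integrable_const c)).div_const 2
  -- Cauchy–Schwarz in the form `2 x ≤ x² / c + c`, optimal for `c = √D`.
  have h1 : ∫ ω in B, (1 - G ω) ∂P ≤ c := by
    calc _ ≤ ∫ ω in B, ((1 - G ω) ^ 2 / c + c) / 2 ∂P := by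
          refine integral_mono ((integrable_const 1).sub hGint).integrableOn hquad.integrableOn
            fun ω => ?_
          have : (1 - G ω) ^ 2 / c + c - 2 * (1 - G ω) = (1 - G ω - c) ^ 2 / c := by
            field_simp
            ring
          have h2 : 0 ≤ (1 - G ω - c) ^ 2 / c := by positivity
          beta_reduce
          linarith
      _ ≤ ∫ ω, ((1 - G ω) ^ 2 / c + c) / 2 ∂P :=
          setIntegral_le_integral hquad (ae_of_all _ fun ω => by
            have : 0 ≤ (1 - G ω) ^ 2 / c := by positivity
            show 0 ≤ ((1 - G ω) ^ 2 / c + c) / 2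
            linarith)
      _ = ((∫ ω, (1 - G ω) ^ 2 ∂P) / c + c) / 2 := by
          rw [integral_div, integral_add (hsqint.div_const c) (integrable_const c), integral_div]
          simp
      _ ≤ (D / c + c) / 2 := by gcongr
      _ = c := by
          rw [← hcD]
          field_simp
          ring
  -- Truncation only lowers the likelihood, so a lower bound with `G` remains one for the true type
  -- II errors.
  have h2 : ∫ ω in B, G ω ∂P
      ≤ (J.card : ℝ)⁻¹ * ∑ k ∈ J, ∫ ω in B, Real.exp (a * W (v k) ω - a ^ 2 / 2) ∂P := by
    rw [hG, integral_const_mul, integral_finsetSum _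
      fun k _ => (hW.integrable_truncLikelihood ha _ _).integrableOn]
    gcongr with k hk
    · exact (hW.integrable_truncLikelihood ha _ _).integrableOn
    · exact (hW.integrable_exp_sub _ _ _).integrableOn
    · exact truncLikelihood_le ..
  rw [integral_sub (integrable_const 1).integrableOn hGint.integrableOn] at h1
  simp only [integral_const, smul_eq_mul, mul_one, measureReal_restrict_apply_univ] at h1
  have h3 : P.real B + P.real Bᶜ = 1 := by
    rw [measureReal_compl₀ hB]
    simp
  linarith

end IsIsonormal

end TruncatedSecondMoment

end InverseDetection

namespace InverseDetection

/-! ### Lower bound for the minimax error -/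

section LowerBound

variable {𝕜 X Y Ω ι I : Type*} [RCLike 𝕜]
  [NormedAddCommGroup X] [InnerProductSpace 𝕜 X]
  [NormedAddCommGroup Y] [InnerProductSpace 𝕜 Y]
  [MeasurableSpace Ω] {P : Measure Ω} [IsProbabilityMeasure P] [Countable ι]

lemma dataLaw_apply_eq_ofReal_setIntegral (A : X →L[𝕜] Y)
    {ξ : Y →ₗ[𝕜] Lp 𝕜 2 P} (hξ : IsGaussianWhiteNoise P ξ) (e : HilbertBasis ι 𝕜 Y)
    {σ : ℝ} (hσ : σ ≠ 0) (f : X) {S : Set (ι → 𝕜)} (hS : MeasurableSet S) :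
    dataLaw A ξ e σ f S = ENNReal.ofReal
      (∫ ω in {ω | (fun i => observation A ξ σ 0 (e i) ω) ∈ S},
        likelihood ξ e (((σ⁻¹ : ℝ) : 𝕜) • A f) ω ∂P) := by
  have hm := aemeasurable_data A ξ e σ 0
  have hint := integrable_likelihood hξ e (((σ⁻¹ : ℝ) : 𝕜) • A f)
  have hB : NullMeasurableSet ((fun ω i => observation A ξ σ 0 (e i) ω) ⁻¹' S) P :=
    hm.nullMeasurable hS
  rw [dataLaw_eq_map_withDensity A hξ e hσ f,
    Measure.map_apply_of_aemeasurable (hm.mono_ac (withDensity_absolutelyContinuous _ _)) hS,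
    withDensity_apply₀ _ hB, ofReal_integral_eq_lintegral_ofReal hint.integrableOn
      (ae_of_all _ fun ω => Real.exp_nonneg _)]
  rfl

/-- Non-asymptotic lower bound for the minimax error. -/
theorem one_sub_sqrt_le_minimaxError (A : X →L[𝕜] Y)
    {ξ : Y →ₗ[𝕜] Lp 𝕜 2 P} (hξ : IsGaussianWhiteNoise P ξ) (e : HilbertBasis ι 𝕜 Y)
    (u : I → X) {J : Finset I} (hJ : J.Nonempty) (hu : ∀ k ∈ J, A (u k) ≠ 0)
    {σ : ℝ} (hσ : 0 < σ) {s τ μ : ℝ} (hs : 0 ≤ s) (hsτ : 2 * s ≤ τ)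
    (hτ : τ = √(2 * Real.log J.card)) (hμ : μ ≤ σ * (τ - s)) :
    ENNReal.ofReal (1 - √(2 * Real.exp (-s ^ 2 / 2)
        + maxNonnegCorrelated A u J * Real.exp (-s ^ 2)))
      ≤ minimaxError A ξ e σ (alternative A u J μ) := by
  classical
  let := InnerProductSpace.rclikeToReal 𝕜 Y
  have hW := isIsonormal_realNoise hξ e
  set v : I → Y := fun k => ((‖A (u k)‖⁻¹ : ℝ) : 𝕜) • A (u k) with hv
  have hpos : ∀ k ∈ J, 0 < ‖A (u k)‖⁻¹ := fun k hk => inv_pos.2 (norm_pos_iff.2 (hu k hk))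
  have hv1 : ∀ k ∈ J, ‖v k‖ = 1 := fun k hk => by
    rw [hv]
    beta_reduce
    rw [norm_smul, RCLike.norm_ofReal, abs_of_pos (hpos k hk),
      inv_mul_cancel₀ (norm_ne_zero_iff.2 (hu k hk))]
  have hM : ∀ k ∈ J, (J.filter fun k' => 0 ≤ inner ℝ (v k) (v k')).card
      ≤ maxNonnegCorrelated A u J := by
    intro k hk
    have h1 : (J.filter fun k' => 0 ≤ inner ℝ (v k) (v k'))
        = J.filter fun k' => 0 ≤ RCLike.re (inner 𝕜 (A (u k)) (A (u k'))) := by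
      refine Finset.filter_congr fun k' hk' => ?_
      have h2 : inner ℝ (v k) (v k') = RCLike.re (inner 𝕜 (v k) (v k')) := rfl
      rw [h2, hv]
      beta_reduce
      rw [inner_smul_left, inner_smul_right, RCLike.conj_ofReal, RCLike.re_ofReal_mul,
        RCLike.re_ofReal_mul, mul_nonneg_iff_of_pos_left (hpos k hk),
        mul_nonneg_iff_of_pos_left (hpos k' hk')]
    rw [h1, maxNonnegCorrelated]
    exact Finset.le_sup (f := fun k =>
      (J.filter fun k' => 0 ≤ RCLike.re (inner 𝕜 (A (u k)) (A (u k')))).card) hk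
  set a := τ - s with ha
  refine le_iInf fun φ => ?_
  have hm := aemeasurable_data A ξ e σ 0
  have hS0 : MeasurableSet {y | φ.1 y = 0} := φ.2 (measurableSet_singleton 0)
  have hS1 : MeasurableSet {y | φ.1 y = 1} := φ.2 (measurableSet_singleton 1)
  set B : Set Ω := {ω | (fun i => observation A ξ σ 0 (e i) ω) ∈ {y | φ.1 y = 0}} with hBdef
  have hB : NullMeasurableSet B P := hm.nullMeasurable hS0
  have hlow := hW.one_sub_sqrt_le_error hJ hv1 hM hs (by linarith : s ≤ a)
    (by rw [ha, sub_add_cancel, hτ]) hB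
  have herr0 : dataLaw A ξ e σ 0 {y | φ.1 y = 1} = ENNReal.ofReal (P.real Bᶜ) := by
    rw [dataLaw, Measure.map_apply_of_aemeasurable hm hS1, ofReal_measureReal]
    congr 1
    ext ω
    simp only [hBdef, Set.mem_preimage, Set.mem_ofPred_eq, Set.mem_compl_iff]
    omega
  -- The worst type II error is at least the average one, hence a single `k`, depending on the test,
  -- suffices.
  obtain ⟨k, hk, hkavg⟩ : ∃ k ∈ J, (J.card : ℝ)⁻¹ *
      ∑ k ∈ J, ∫ ω in B, Real.exp (a * realNoise ξ e (v k) ω - a ^ 2 / 2) ∂P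
      ≤ ∫ ω in B, Real.exp (a * realNoise ξ e (v k) ω - a ^ 2 / 2) ∂P := by
    refine Finset.exists_le_of_sum_le hJ ?_
    have hN : (J.card : ℝ) ≠ 0 := by exact_mod_cast hJ.card_pos.ne'
    rw [Finset.sum_const, nsmul_eq_mul, mul_inv_cancel_left₀ hN]
  set f : X := (((σ * a : ℝ) : 𝕜)) • (((‖A (u k)‖⁻¹ : ℝ) : 𝕜) • u k) with hf
  have hfmem : f ∈ alternative A u J μ := by
    refine ⟨k, hk, ((σ * a : ℝ) : 𝕜), ?_, rfl⟩
    rw [RCLike.norm_ofReal]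
    exact hμ.trans (le_abs_self _)
  have hAf : ((σ⁻¹ : ℝ) : 𝕜) • A f = a • v k := by
    have : a • v k = (a : 𝕜) • v k := rfl
    rw [this, hf, map_smul, map_smul, smul_smul, ← RCLike.ofReal_mul,
      inv_mul_cancel_left₀ hσ.ne']
  have herrk : dataLaw A ξ e σ f {y | φ.1 y = 0} = ENNReal.ofReal
      (∫ ω in B, Real.exp (a * realNoise ξ e (v k) ω - a ^ 2 / 2) ∂P) := by
    rw [dataLaw_apply_eq_ofReal_setIntegral A hξ e hσ.ne' f hS0, hAf]
    congr 1
    refine integral_congr_ae (ae_restrict_of_ae ?_)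
    filter_upwards [hW.smul_ae a (v k)] with ω hω
    rw [likelihood, hω, norm_smul, hv1 k hk, mul_one, Real.norm_eq_abs, sq_abs]
  calc _ ≤ ENNReal.ofReal (P.real Bᶜ +
        ∫ ω in B, Real.exp (a * realNoise ξ e (v k) ω - a ^ 2 / 2) ∂P) :=
        ENNReal.ofReal_le_ofReal (by linarith)
    _ = dataLaw A ξ e σ 0 {y | φ.1 y = 1} + dataLaw A ξ e σ f {y | φ.1 y = 0} := by
        rw [herr0, herrk, ENNReal.ofReal_add measureReal_nonneg
          (integral_nonneg fun ω => Real.exp_nonneg _)]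
    _ ≤ _ := by
        gcongr
        exact le_iSup₂ (f := fun f _ => dataLaw A ξ e σ f {y | φ.1 y = 0}) f hfmem

lemma minimaxError_le_one (A : X →L[𝕜] Y) (ξ : Y →ₗ[𝕜] Lp 𝕜 2 P) (e : HilbertBasis ι 𝕜 Y)
    (σ : ℝ) (F : Set X) : minimaxError A ξ e σ F ≤ 1 := by
  refine (iInf_le _ ⟨fun _ => 1, measurable_const⟩).trans ?_
  have : IsProbabilityMeasure (dataLaw A ξ e σ 0) :=
    Measure.isProbabilityMeasure_map (aemeasurable_data A ξ e σ 0)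
  simp

end LowerBound

end InverseDetection

namespace InverseDetection

/-! ### Noise tails and the maximum test -/

section Tail

variable {𝕜 Y Ω ι : Type*} [RCLike 𝕜] [NormedAddCommGroup Y] [InnerProductSpace 𝕜 Y]
  [MeasurableSpace Ω] {P : Measure Ω}

lemma integral_exp_sq_gaussianReal {θ : ℝ} (hθ : θ < 1) :
    ∫ x, Real.exp (θ * x ^ 2 / 2) ∂(gaussianReal 0 1) = (√(1 - θ))⁻¹ := by
  have h1 : 0 < 1 - θ := by linarith
  rw [integral_gaussianReal_eq_integral_smul one_ne_zero]
  have h2 : ∀ x : ℝ, gaussianPDFReal 0 1 x • Real.exp (θ * x ^ 2 / 2)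
      = (√(2 * Real.pi))⁻¹ * Real.exp (-((1 - θ) / 2) * x ^ 2) := by
    intro x
    rw [gaussianPDFReal, smul_eq_mul, mul_assoc, ← Real.exp_add]
    simp only [NNReal.coe_one, mul_one, sub_zero]
    congr 2
    ring
  simp_rw [h2]
  rw [integral_const_mul, integral_gaussian]
  have h3 : Real.pi / ((1 - θ) / 2) = (2 * Real.pi) * (1 - θ)⁻¹ := by
    field_simp
  rw [h3, Real.sqrt_mul (x := 2 * Real.pi) (by positivity), Real.sqrt_inv, inv_mul_cancel_left₀]
  positivity

lemma norm_sq_ofReal_add_ofReal_mul_I_le (x y : ℝ) :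
    ‖(x : 𝕜) + (y : 𝕜) * (RCLike.I : 𝕜)‖ ^ 2 ≤ x ^ 2 + y ^ 2 := by
  rw [RCLike.norm_sq_eq_def]
  rcases RCLike.I_eq_zero_or_im_I_eq_one (K := 𝕜) with h | h
  -- In the real case `I = 0` and the second coordinate is simply dropped.
  · simp [h]
    nlinarith [sq_nonneg y]
  · simp [h]
    nlinarith

/-- Markov's inequality for `exp (θ (x² + y²) / 2)`, each coordinate contributing `(1 - θ)^(-1/2)`.
The parameter `θ` stays free so that it can approach `1`, which keeps the constant in the boundary
sharp. -/
lemma noiseLaw_one_tail {θ t : ℝ} (hθ0 : 0 ≤ θ) (hθ : θ < 1) (ht : 0 ≤ t) :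
    noiseLaw 𝕜 1 {z | t ≤ ‖z‖} ≤ ENNReal.ofReal (Real.exp (-(θ * t ^ 2 / 2)) / (1 - θ)) := by
  have h1 : 0 < 1 - θ := by linarith
  set γ := (gaussianReal 0 1).prod (gaussianReal 0 1) with hγ
  have hI : Integrable (fun x : ℝ => Real.exp (θ * x ^ 2 / 2)) (gaussianReal 0 1) :=
    .of_integral_ne_zero (by
      rw [integral_exp_sq_gaussianReal hθ]
      positivity)
  have hint : Integrable (fun p : ℝ × ℝ => Real.exp (θ * p.1 ^ 2 / 2) * Real.exp (θ * p.2 ^ 2 / 2))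
      γ := hI.mul_prod hI
  have hval : ∫ p, Real.exp (θ * p.1 ^ 2 / 2) * Real.exp (θ * p.2 ^ 2 / 2) ∂γ = (1 - θ)⁻¹ := by
    rw [hγ, integral_prod_mul (fun x : ℝ => Real.exp (θ * x ^ 2 / 2))
      (fun x : ℝ => Real.exp (θ * x ^ 2 / 2)), integral_exp_sq_gaussianReal hθ, ← mul_inv,
      Real.mul_self_sqrt h1.le]
  have hmark := mul_meas_ge_le_integral_of_nonneg (ae_of_all _ fun p : ℝ × ℝ => by positivity)
    hint (Real.exp (θ * t ^ 2 / 2))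
  rw [hval] at hmark
  have hsub : noiseLaw 𝕜 1 {z | t ≤ ‖z‖}
      ≤ γ {p | Real.exp (θ * t ^ 2 / 2) ≤ Real.exp (θ * p.1 ^ 2 / 2) * Real.exp (θ * p.2 ^ 2 / 2)} := by
    rw [noiseLaw, Measure.map_apply (by fun_prop)
      (measurableSet_le measurable_const measurable_norm)]
    refine measure_mono fun p hp => ?_
    have h2 : t ^ 2 ≤ p.1 ^ 2 + p.2 ^ 2 :=
      (pow_le_pow_left₀ ht hp 2).trans (norm_sq_ofReal_add_ofReal_mul_I_le p.1 p.2)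
    show Real.exp (θ * t ^ 2 / 2) ≤ Real.exp (θ * p.1 ^ 2 / 2) * Real.exp (θ * p.2 ^ 2 / 2)
    rw [← Real.exp_add, Real.exp_le_exp]
    have := mul_le_mul_of_nonneg_left h2 hθ0
    linarith
  refine hsub.trans ?_
  rw [← ofReal_measureReal]
  refine ENNReal.ofReal_le_ofReal ?_
  rw [Real.exp_neg, div_eq_mul_inv (Real.exp _)⁻¹]
  exact (le_inv_mul_iff₀ (Real.exp_pos _)).2 hmark

lemma noise_tail {ξ : Y →ₗ[𝕜] Lp 𝕜 2 P} (hξ : IsGaussianWhiteNoise P ξ) {h : Y} (hh : ‖h‖ = 1)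
    {θ t : ℝ} (hθ0 : 0 ≤ θ) (hθ : θ < 1) (ht : 0 ≤ t) :
    P {ω | t ≤ ‖ξ h ω‖} ≤ ENNReal.ofReal (Real.exp (-(θ * t ^ 2 / 2)) / (1 - θ)) := by
  have h1 : ‖h‖₊ = 1 := NNReal.eq hh
  have h2 := hξ.law_eq h
  rw [h1, one_pow] at h2
  have h3 := Measure.map_apply_of_aemeasurable (aemeasurable_noise ξ h) (s := {z | t ≤ ‖z‖})
    (measurableSet_le measurable_const measurable_norm)
  rw [h2] at h3
  exact h3.symm.trans_le (noiseLaw_one_tail hθ0 hθ ht)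

/-- Finite normalized combinations of a Hilbert basis approximate every unit vector. -/
lemma exists_sum_norm_eq_one_le_norm_inner (e : HilbertBasis ι 𝕜 Y) {v : Y} (hv : ‖v‖ = 1)
    {η : ℝ} (hη : η < 1) :
    ∃ (s : Finset ι) (c : ι → 𝕜), ‖∑ i ∈ s, c i • e i‖ = 1 ∧
      η ≤ ‖inner 𝕜 (∑ i ∈ s, c i • e i) v‖ := by
  have h1 : Tendsto (fun s : Finset ι => ∑ i ∈ s, e.repr v i • e i) atTop (𝓝 v) := e.hasSum_repr v
  have h2 : Tendsto (fun s : Finset ι => ‖∑ i ∈ s, e.repr v i • e i‖) atTop (𝓝 1) := by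
    simpa [hv] using h1.norm
  have h3 : Tendsto (fun s : Finset ι => ‖∑ i ∈ s, e.repr v i • e i‖⁻¹
      * ‖inner 𝕜 (∑ i ∈ s, e.repr v i • e i) v‖) atTop (𝓝 1) := by
    have := (h2.inv₀ one_ne_zero).mul (h1.inner (𝕜 := 𝕜) (tendsto_const_nhds (x := v))).norm
    simpa [inner_self_eq_norm_sq_to_K, hv] using this
  obtain ⟨s, hs1, hs2⟩ := ((h2.eventually_ne one_ne_zero).and
    (h3.eventually (lt_mem_nhds hη))).exists
  set p := ∑ i ∈ s, e.repr v i • e i with hp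
  have hsum : ∑ i ∈ s, (((‖p‖⁻¹ : ℝ) : 𝕜) * e.repr v i) • e i = ((‖p‖⁻¹ : ℝ) : 𝕜) • p := by
    rw [hp, Finset.smul_sum]
    simp_rw [smul_smul]
  refine ⟨s, fun i => ((‖p‖⁻¹ : ℝ) : 𝕜) * e.repr v i, ?_, ?_⟩
  · rw [hsum, norm_smul, RCLike.norm_ofReal, abs_of_nonneg (by positivity), inv_mul_cancel₀ hs1]
  · rw [hsum, inner_smul_left, RCLike.conj_ofReal, norm_mul, RCLike.norm_ofReal,
      abs_of_nonneg (by positivity)]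
    exact hs2.le

end Tail

section UpperBound

variable {𝕜 X Y Ω ι I : Type*} [RCLike 𝕜]
  [NormedAddCommGroup X] [InnerProductSpace 𝕜 X]
  [NormedAddCommGroup Y] [InnerProductSpace 𝕜 Y]
  [MeasurableSpace Ω] {P : Measure Ω}

lemma sum_conj_mul_observation (A : X →L[𝕜] Y) (ξ : Y →ₗ[𝕜] Lp 𝕜 2 P) (e : HilbertBasis ι 𝕜 Y)
    (σ : ℝ) (f : X) (s : Finset ι) (c : ι → 𝕜) :
    ∀ᵐ ω ∂P, ∑ i ∈ s, conj (c i) * observation A ξ σ f (e i) ω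
      = inner 𝕜 (∑ i ∈ s, c i • e i) (A f)
        + (σ : 𝕜) * ξ (conjCoord e (∑ i ∈ s, c i • e i)) ω := by
  have h1 : ∀ᵐ ω ∂P, ∀ i ∈ s, (conj (c i) • ξ (e i) : Lp 𝕜 2 P) ω = conj (c i) • ξ (e i) ω :=
    (Finset.eventually_all s).2 fun i _ => Lp.coeFn_smul (conj (c i)) (ξ (e i))
  filter_upwards [h1, Lp.coeFn_finsetSum s fun i => conj (c i) • ξ (e i)] with ω h1 h2
  rw [conjCoord_sum, map_sum]
  simp_rw [map_smul]
  rw [h2, Finset.sum_apply, sum_inner, Finset.mul_sum, ← Finset.sum_add_distrib]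
  refine Finset.sum_congr rfl fun i hi => ?_
  rw [h1 i hi, observation, inner_smul_left, smul_eq_mul]
  ring

/-- Non-asymptotic upper bound for the minimax error, attained by a maximum test. -/
theorem minimaxError_le [Countable ι] (A : X →L[𝕜] Y)
    {ξ : Y →ₗ[𝕜] Lp 𝕜 2 P} (hξ : IsGaussianWhiteNoise P ξ) (e : HilbertBasis ι 𝕜 Y)
    (u : I → X) {J : Finset I} (hu : ∀ k ∈ J, A (u k) ≠ 0)
    {σ : ℝ} (hσ : 0 < σ) {t r μ θ : ℝ} (ht : 0 ≤ t) (hr : 0 ≤ r) (hμ : σ * (t + r) < μ)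
    (hθ0 : 0 ≤ θ) (hθ : θ < 1) :
    minimaxError A ξ e σ (alternative A u J μ)
      ≤ ENNReal.ofReal (J.card * (Real.exp (-(θ * t ^ 2 / 2)) / (1 - θ))
        + 2 * Real.exp (-(r ^ 2 / 4))) := by
  classical
  have hμ0 : 0 < μ := lt_of_le_of_lt (by positivity) hμ
  set v : I → Y := fun k => ((‖A (u k)‖⁻¹ : ℝ) : 𝕜) • A (u k) with hv
  have hv1 : ∀ k ∈ J, ‖v k‖ = 1 := fun k hk => by
    rw [hv]
    beta_reduce
    rw [norm_smul, RCLike.norm_ofReal, abs_of_nonneg (by positivity),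
      inv_mul_cancel₀ (norm_ne_zero_iff.2 (hu k hk))]
  -- The strict inequality in `hμ` leaves room to replace `v k` by a finite combination `w k` of
  -- basis vectors, so that the test statistic is a measurable function of the data.
  have hη : σ * (t + r) / μ < 1 := (div_lt_one hμ0).2 hμ
  have hex : ∀ k, ∃ (s : Finset ι) (c : ι → 𝕜), k ∈ J → ‖∑ i ∈ s, c i • e i‖ = 1 ∧
      σ * (t + r) / μ ≤ ‖inner 𝕜 (∑ i ∈ s, c i • e i) (v k)‖ := by
    intro k
    by_cases hk : k ∈ J
    · obtain ⟨s, c, h⟩ := exists_sum_norm_eq_one_le_norm_inner e (hv1 k hk) hη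
      exact ⟨s, c, fun _ => h⟩
    · exact ⟨∅, 0, fun h => absurd h hk⟩
  choose s c hsc using hex
  set w : I → Y := fun k => ∑ i ∈ s k, c k i • e i with hw
  set S : Set (ι → 𝕜) := ⋃ k ∈ J, {y | σ * t < ‖∑ i ∈ s k, conj (c k i) * y i‖} with hS
  have hSm : MeasurableSet S := by
    refine Finset.measurableSet_biUnion J fun k _ => ?_
    exact measurableSet_lt measurable_const (by fun_prop)
  have hwn : ∀ k ∈ J, ‖conjCoord e (w k)‖ = 1 := fun k hk => by
    rw [norm_conjCoord]
    exact (hsc k hk).1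
  have hobs : ∀ f, ∀ᵐ ω ∂P, ∀ k ∈ J, ∑ i ∈ s k, conj (c k i) * observation A ξ σ f (e i) ω
      = inner 𝕜 (w k) (A f) + (σ : 𝕜) * ξ (conjCoord e (w k)) ω := fun f =>
    (Finset.eventually_all J).2 fun k _ => sum_conj_mul_observation A ξ e σ f (s k) (c k)
  have h0 : dataLaw A ξ e σ 0 S
      ≤ ENNReal.ofReal (J.card * (Real.exp (-(θ * t ^ 2 / 2)) / (1 - θ))) := by
    rw [dataLaw, Measure.map_apply_of_aemeasurable (aemeasurable_data A ξ e σ 0) hSm]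
    calc _ ≤ P (⋃ k ∈ J, {ω | t ≤ ‖ξ (conjCoord e (w k)) ω‖}) := by
          refine measure_mono_ae ?_
          filter_upwards [hobs 0] with ω hω hmem
          have hmem' : (fun i => observation A ξ σ 0 (e i) ω) ∈ S := hmem
          obtain ⟨k, hk, hmem⟩ := Set.mem_iUnion₂.1 hmem'
          have h1 : σ * t < ‖∑ i ∈ s k, conj (c k i) * observation A ξ σ 0 (e i) ω‖ := hmem
          rw [hω k hk, map_zero, inner_zero_right, zero_add, norm_mul, RCLike.norm_ofReal,
            abs_of_pos hσ] at h1
          exact Set.mem_biUnion hk (lt_of_mul_lt_mul_left h1 hσ.le).le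
      _ ≤ ∑ k ∈ J, P {ω | t ≤ ‖ξ (conjCoord e (w k)) ω‖} := measure_biUnion_finset_le _ _
      _ ≤ ∑ _k ∈ J, ENNReal.ofReal (Real.exp (-(θ * t ^ 2 / 2)) / (1 - θ)) :=
          Finset.sum_le_sum fun k hk => noise_tail hξ (hwn k hk) hθ0 hθ ht
      _ = _ := by
          rw [Finset.sum_const, nsmul_eq_mul, ENNReal.ofReal_mul (by positivity),
            ENNReal.ofReal_natCast]
  have h1 : ∀ f ∈ alternative A u J μ, dataLaw A ξ e σ f Sᶜ
      ≤ ENNReal.ofReal (2 * Real.exp (-(r ^ 2 / 4))) := by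
    rintro f ⟨k, hk, δ, hδ, hf⟩
    rw [dataLaw, Measure.map_apply_of_aemeasurable (aemeasurable_data A ξ e σ f) hSm.compl]
    calc _ ≤ P {ω | r ≤ ‖ξ (conjCoord e (w k)) ω‖} := by
          refine measure_mono_ae ?_
          filter_upwards [hobs f] with ω hω hmem
          have h2 : ‖∑ i ∈ s k, conj (c k i) * observation A ξ σ f (e i) ω‖ ≤ σ * t := by
            by_contra h
            exact hmem (Set.mem_biUnion hk (not_le.1 h))
          have h3 : A f = δ • v k := by rw [hf, map_smul, map_smul]
          rw [hω k hk, h3, inner_smul_right] at h2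
          -- The amplitude `‖δ‖ ≥ μ` makes up for the approximation factor. A statistic below `σ t`
          -- then forces the noise to be at least `r`.
          have h4 : σ * (t + r) ≤ ‖δ * inner 𝕜 (w k) (v k)‖ := by
            have h5 := (hsc k hk).2
            rw [div_le_iff₀ hμ0] at h5
            rw [norm_mul]
            calc _ ≤ _ := h5
              _ ≤ ‖inner 𝕜 (w k) (v k)‖ * ‖δ‖ := by gcongr
              _ = _ := mul_comm _ _
          have h6 := norm_sub_le_norm_add (δ * inner 𝕜 (w k) (v k))
            ((σ : 𝕜) * ξ (conjCoord e (w k)) ω)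
          rw [norm_mul (σ : 𝕜), RCLike.norm_ofReal, abs_of_pos hσ] at h6
          have h7 : σ * r ≤ σ * ‖ξ (conjCoord e (w k)) ω‖ := by linarith
          exact le_of_mul_le_mul_left h7 hσ
      _ ≤ _ := by
          refine (noise_tail hξ (hwn k hk) (θ := 1 / 2) (by norm_num) (by norm_num) hr).trans_eq ?_
          congr 1
          rw [show 1 / 2 * r ^ 2 / 2 = r ^ 2 / 4 by ring]
          ring
  set φ : (ι → 𝕜) → Fin 2 := fun y => if y ∈ S then 1 else 0 with hφ
  have hφm : Measurable φ := Measurable.ite hSm measurable_const measurable_const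
  have e1 : {y | φ y = 1} = S := by
    ext y
    by_cases hy : y ∈ S <;> simp [hφ, hy]
  have e0 : {y | φ y = 0} = Sᶜ := by
    ext y
    by_cases hy : y ∈ S <;> simp [hφ, hy]
  refine (iInf_le _ ⟨φ, hφm⟩).trans ?_
  have hθ' : 0 < 1 - θ := by linarith
  rw [ENNReal.ofReal_add (by positivity) (by positivity)]
  show dataLaw A ξ e σ 0 {y | φ y = 1}
    + ⨆ f ∈ alternative A u J μ, dataLaw A ξ e σ f {y | φ y = 0} ≤ _
  rw [e0, e1]
  exact add_le_add h0 (iSup₂_le h1)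

end UpperBound

end InverseDetection

namespace InverseDetection

/-! ### Comparison of detection boundaries -/

section Boundary

lemma eventuallyLE_iff {a b : ℝ → ℝ} : EventuallyLE a b ↔ ∀ᶠ σ in 𝓝[>] 0, a σ ≤ b σ := by
  rw [(nhdsGT_basis (0 : ℝ)).eventually_iff]
  simp only [EventuallyLE, Set.mem_Ioo, and_imp, gt_iff_lt]

/-- Where `μL > μU`, the family `max μL μU` takes the value `μL`, so the same error would be both
above and below `1/2`. No monotonicity of `γ` is needed, and `μL`, `μU` may stem from different
boundaries. -/
lemma eventuallyLE_of_tendsto {γ : ℝ → ℝ → ℝ≥0∞} {μL μU : ℝ → ℝ}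
    (hL0 : ∀ σ, 0 < σ → 0 ≤ μL σ)
    (hU : ∀ μ : ℝ → ℝ, (∀ σ, 0 < σ → 0 ≤ μ σ) → EventuallyLE μU μ →
      Tendsto (fun σ => γ σ (μ σ)) (𝓝[>] 0) (𝓝 0))
    (hL : ∀ μ : ℝ → ℝ, (∀ σ, 0 < σ → 0 ≤ μ σ) → EventuallyLE μ μL →
      Tendsto (fun σ => γ σ (μ σ)) (𝓝[>] 0) (𝓝 1)) :
    ∀ᶠ σ in 𝓝[>] 0, μL σ ≤ μU σ := by
  have h1 := hL μL hL0 (eventuallyLE_iff.2 (Eventually.of_forall fun _ => le_rfl))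
  have h2 := hU (fun σ => max (μL σ) (μU σ)) (fun σ hσ => (hL0 σ hσ).trans (le_max_left _ _))
    (eventuallyLE_iff.2 (Eventually.of_forall fun _ => le_max_right _ _))
  have h12 : (2⁻¹ : ℝ≥0∞) < 1 := ENNReal.inv_lt_one.2 (by norm_num)
  filter_upwards [h1.eventually (lt_mem_nhds h12),
    h2.eventually (gt_mem_nhds (by simp : (0 : ℝ≥0∞) < 2⁻¹))] with σ h1 h2
  by_contra h
  rw [max_eq_left (not_le.1 h).le] at h2
  exact lt_asymm h1 h2

/-- Two detection boundaries are asymptotically equivalent. -/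
lemma IsDetectionBoundary.asympEquiv {γ : ℝ → ℝ → ℝ≥0∞} {μs μL μU b : ℝ → ℝ}
    (h : IsDetectionBoundary γ μs)
    (hL0 : ∀ σ, 0 < σ → 0 ≤ μL σ)
    (hU : ∀ μ : ℝ → ℝ, (∀ σ, 0 < σ → 0 ≤ μ σ) → EventuallyLE μU μ →
      Tendsto (fun σ => γ σ (μ σ)) (𝓝[>] 0) (𝓝 0))
    (hL : ∀ μ : ℝ → ℝ, (∀ σ, 0 < σ → 0 ≤ μ σ) → EventuallyLE μ μL →
      Tendsto (fun σ => γ σ (μ σ)) (𝓝[>] 0) (𝓝 1))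
    (hb : ∀ᶠ σ in 𝓝[>] 0, 0 < b σ) (hLb : AsympEquiv μL b) (hUb : AsympEquiv μU b) :
    AsympEquiv μs b := by
  obtain ⟨-, νL, νU, νL0, -, νU', νL', hν, hLs, hsU⟩ := h
  -- Crosswise comparison gives `νL ≤ μU` and `μL ≤ νU`. Since `νL / νU → 1`, this squeezes `μs / b`
  -- between `(νL / νU) (μL / b)` and `(μU / b) / (νL / νU)`.
  have h1 := eventuallyLE_of_tendsto νL0 hU νL'
  have h2 := eventuallyLE_of_tendsto hL0 νU' hL
  have hlow := hν.mul hLb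
  have hupp := hUb.div hν one_ne_zero
  rw [mul_one] at hlow
  rw [div_one] at hupp
  -- Positivity of the quotient also excludes `νU σ = 0`, since division by zero yields `0`.
  have hpos : ∀ᶠ σ in 𝓝[>] 0, 0 < νL σ / νU σ := hν.eventually (lt_mem_nhds one_pos)
  refine tendsto_of_tendsto_of_tendsto_of_le_of_le' hlow hupp ?_ ?_
  · filter_upwards [h2, hpos, hb, eventuallyLE_iff.1 hLs] with σ h2 hpos hb hLs
    have hU0 : νU σ ≠ 0 := by
      intro h0
      simp [h0] at hpos
    rw [← mul_div_assoc, div_le_div_iff_of_pos_right hb]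
    calc _ ≤ νL σ / νU σ * νU σ := by gcongr
      _ = νL σ := div_mul_cancel₀ _ hU0
      _ ≤ _ := hLs
  · filter_upwards [h1, hpos, hb, eventuallyLE_iff.1 hsU] with σ h1 hpos hb hsU
    have hU0 : νU σ ≠ 0 := by
      intro h0
      simp [h0] at hpos
    have hself : νL σ / νU σ * νU σ = νL σ := div_mul_cancel₀ _ hU0
    show μs σ / b σ ≤ μU σ / b σ / (νL σ / νU σ)
    rw [div_right_comm, div_le_div_iff_of_pos_right hb, le_div_iff₀ hpos, mul_comm]
    calc _ ≤ νL σ / νU σ * νU σ := by gcongr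
      _ = νL σ := hself
      _ ≤ _ := h1

end Boundary

/-! ### Nondegeneracy of the family and the size of the union bound -/

section Asymptotics

variable {𝕜 X Y I : Type*} [RCLike 𝕜]
  [NormedAddCommGroup X] [InnerProductSpace 𝕜 X]
  [NormedAddCommGroup Y] [InnerProductSpace 𝕜 Y]

lemma card_le_maxNonnegCorrelated (A : X →L[𝕜] Y) (u : I → X) {J : Finset I} {k : I} (hk : k ∈ J)
    (hu : A (u k) = 0) : J.card ≤ maxNonnegCorrelated A u J := by
  classical
  refine le_trans ?_ (Finset.le_sup (f := fun k =>
      (J.filter fun k' => 0 ≤ RCLike.re (inner 𝕜 (A (u k)) (A (u k')))).card) hk)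
  simp [hu]

/-- The operator does not annihilate any of the relevant elements of the family. -/
lemma eventually_forall_ne_zero (A : X →L[𝕜] Y) (u : I → X) {J : ℝ → Finset I}
    (hN : Tendsto (fun σ => (J σ).card) (𝓝[>] 0) atTop) {ε : ℝ → ℝ}
    (hε : Tendsto ε (𝓝[>] 0) (𝓝 0))
    (hM : Tendsto (fun σ => (maxNonnegCorrelated A u (J σ) : ℝ) * ((J σ).card : ℝ) ^ (-ε σ))
      (𝓝[>] 0) (𝓝 0)) :
    ∀ᶠ σ in 𝓝[>] 0, ∀ k ∈ J σ, A (u k) ≠ 0 := by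
  filter_upwards [hN.eventually_ge_atTop 1, hε.eventually (gt_mem_nhds one_pos),
    hM.eventually (gt_mem_nhds one_pos)] with σ h1 h2 h3 k hk hu
  have h4 : (1 : ℝ) ≤ (J σ).card := by exact_mod_cast h1
  have h5 : ((J σ).card : ℝ) ≤ maxNonnegCorrelated A u (J σ) := by
    exact_mod_cast card_le_maxNonnegCorrelated A u hk hu
  -- A vector with `A u_k = 0` has zero inner product with all others, so `M ≥ N` and `M N^(-ε) ≥
  -- N^(1-ε) ≥ 1`.
  refine absurd h3 (not_lt.2 ?_)
  calc (1 : ℝ) ≤ ((J σ).card : ℝ) ^ (1 - ε σ) := Real.one_le_rpow h4 (by linarith)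
    _ = (J σ).card * ((J σ).card : ℝ) ^ (-ε σ) := by
        rw [sub_eq_add_neg, Real.rpow_add (by linarith), Real.rpow_one]
    _ ≤ _ := by gcongr

/-- Union bound at threshold `τ + s` with `θ = 1 - τ⁻²`. The factor `1 / (1 - θ)` costs only `τ²`,
and `(τ + s)² ≤ 4 τ²` limits the loss in the exponent to `2`. As `N = exp (τ² / 2)`, the exponent
left is at most `2 - τ s ≤ 2 - τ`. -/
lemma card_mul_exp_div_le {N : ℕ} (hN : 1 ≤ N) {τ s : ℝ} (hτ : τ = √(2 * Real.log N))
    (hτ0 : 0 < τ) (hs : 1 ≤ s) (hsτ : s ≤ τ) :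
    N * (Real.exp (-((1 - (τ ^ 2)⁻¹) * (τ + s) ^ 2 / 2)) / (1 - (1 - (τ ^ 2)⁻¹)))
      ≤ Real.exp 2 * (τ ^ 2 * Real.exp (-τ)) := by
  have hN0 : (0 : ℝ) < N := by exact_mod_cast hN
  have hlog : Real.log N = τ ^ 2 / 2 := by
    have : 0 ≤ Real.log N := Real.log_natCast_nonneg N
    rw [hτ, Real.sq_sqrt (by positivity)]
    ring
  have hNexp : (N : ℝ) = Real.exp (τ ^ 2 / 2) := by rw [← hlog, Real.exp_log hN0]
  have h1 : (τ ^ 2)⁻¹ * (τ + s) ^ 2 ≤ 4 := by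
    rw [inv_mul_le_iff₀ (by positivity)]
    nlinarith
  have h2 : τ ^ 2 / 2 + -((1 - (τ ^ 2)⁻¹) * (τ + s) ^ 2 / 2) ≤ 2 + -τ := by nlinarith
  calc _ = τ ^ 2 * Real.exp (τ ^ 2 / 2 + -((1 - (τ ^ 2)⁻¹) * (τ + s) ^ 2 / 2)) := by
        rw [sub_sub_cancel, div_inv_eq_mul, hNexp, Real.exp_add]
        ring
    _ ≤ τ ^ 2 * Real.exp (2 + -τ) := by gcongr
    _ = _ := by
        rw [Real.exp_add]
        ring

end Asymptotics

end InverseDetection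

/-! ### The detection boundary -/

open InverseDetection

theorem corollary3p3
    {𝕜 X Y Ω ι I : Type*} [RCLike 𝕜]
    [NormedAddCommGroup X] [InnerProductSpace 𝕜 X] [CompleteSpace X]
    [NormedAddCommGroup Y] [InnerProductSpace 𝕜 Y] [CompleteSpace Y]
    [MeasurableSpace Ω] (P : Measure Ω) [IsProbabilityMeasure P]
    [Countable ι] [Countable I]
    (A : X →L[𝕜] Y)
    (ξ : Y →ₗ[𝕜] Lp 𝕜 2 P) (hξ : InverseDetection.IsGaussianWhiteNoise P ξ)
    (e : HilbertBasis ι 𝕜 Y)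
    (u : I → X) (J : ℝ → Finset I)
    (hN : Tendsto (fun σ => (J σ).card) (𝓝[>] 0) atTop)
    (ε : ℝ → ℝ)
    (hε : Tendsto ε (𝓝[>] 0) (𝓝 0))
    (hεN : Tendsto (fun σ => ε σ * √(Real.log (J σ).card)) (𝓝[>] 0) atTop)
    (hM : Tendsto
      (fun σ => (InverseDetection.maxNonnegCorrelated A u (J σ) : ℝ) * ((J σ).card : ℝ) ^ (-ε σ))
      (𝓝[>] 0) (𝓝 0)) :
    InverseDetection.IsDetectionBoundary
      (fun σ μ => InverseDetection.minimaxError A ξ e σ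
        (InverseDetection.alternative A u (J σ) μ))
      (fun σ => √(2 * σ ^ 2 * Real.log (J σ).card)) ∧
    ∀ μs : ℝ → ℝ,
      InverseDetection.IsDetectionBoundary
        (fun σ μ => InverseDetection.minimaxError A ξ e σ
          (InverseDetection.alternative A u (J σ) μ)) μs →
      InverseDetection.AsympEquiv μs (fun σ => √(2 * σ ^ 2 * Real.log (J σ).card)) := by
  have hlog : Tendsto (fun σ => Real.log (J σ).card) (𝓝[>] 0) atTop :=
    Real.tendsto_log_atTop.comp (tendsto_natCast_atTop_atTop.comp hN)
  have hsqrtlog : Tendsto (fun σ => √(Real.log (J σ).card)) (𝓝[>] 0) atTop :=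
    Real.tendsto_sqrt_atTop.comp hlog
  have hεlog : Tendsto (fun σ => ε σ * Real.log (J σ).card) (𝓝[>] 0) atTop := by
    refine (hεN.atTop_mul_atTop₀ hsqrtlog).congr fun σ => ?_
    rw [mul_assoc, Real.mul_self_sqrt (Real.log_natCast_nonneg _)]
  set τ : ℝ → ℝ := fun σ => √(2 * Real.log (J σ).card) with hτ
  -- This choice gives `exp (-s²) = N^(-ε)` and `s / τ = √(ε / 2)` for small `σ`. The radicand is
  -- eventually positive because it tends to infinity.
  set s : ℝ → ℝ := fun σ => √(ε σ * Real.log (J σ).card) with hs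
  set b : ℝ → ℝ := fun σ => √(2 * σ ^ 2 * Real.log (J σ).card) with hb
  have hbτ : ∀ σ, 0 < σ → b σ = σ * τ σ := fun σ hσ => by
    have : 2 * σ ^ 2 * Real.log (J σ).card = σ ^ 2 * (2 * Real.log (J σ).card) := by ring
    rw [hb, hτ]
    beta_reduce
    rw [this, Real.sqrt_mul (sq_nonneg σ), Real.sqrt_sq hσ.le]
  have hs0 : ∀ σ, 0 ≤ s σ := fun σ => Real.sqrt_nonneg _
  have hτ0 : ∀ σ, 0 ≤ τ σ := fun σ => Real.sqrt_nonneg _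
  have hτtop : Tendsto τ (𝓝[>] 0) atTop :=
    Real.tendsto_sqrt_atTop.comp (hlog.const_mul_atTop two_pos)
  have hs_top : Tendsto s (𝓝[>] 0) atTop := Real.tendsto_sqrt_atTop.comp hεlog
  have hsτ : Tendsto (fun σ => s σ / τ σ) (𝓝[>] 0) (𝓝 0) := by
    have h1 : Tendsto (fun σ => √(ε σ / 2)) (𝓝[>] 0) (𝓝 0) := by
      simpa using (hε.div_const 2).sqrt
    refine h1.congr' ?_
    filter_upwards [hlog.eventually_gt_atTop 0] with σ hσ
    rw [hs, hτ]
    beta_reduce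
    rw [← Real.sqrt_div' _ (by positivity), mul_div_mul_right _ _ hσ.ne']
  have hτpos := hτtop.eventually_gt_atTop 0
  have hspos := hs_top.eventually_ge_atTop 1
  have h2sτ : ∀ᶠ σ in 𝓝[>] 0, 2 * s σ ≤ τ σ := by
    filter_upwards [hτpos, hsτ.eventually (gt_mem_nhds (by norm_num : (0 : ℝ) < 1 / 2))]
      with σ h1 h2
    rw [div_lt_iff₀ h1] at h2
    linarith
  have hσpos : ∀ᶠ σ : ℝ in 𝓝[>] 0, 0 < σ := self_mem_nhdsWithin
  have hu := eventually_forall_ne_zero A u hN hε hM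
  -- The maximum ensures nonnegativity for every `σ > 0`; it is inactive for small `σ`.
  set μL : ℝ → ℝ := fun σ => max 0 (σ * (τ σ - s σ)) with hμL
  -- The test uses threshold `τ + s` and margin `s`; the third `s` provides the strict inequality
  -- required by `minimaxError_le`.
  set μU : ℝ → ℝ := fun σ => σ * (τ σ + 3 * s σ) with hμU
  have hL0 : ∀ σ, 0 < σ → 0 ≤ μL σ := fun σ _ => le_max_left _ _
  have hU0 : ∀ σ, 0 < σ → 0 ≤ μU σ := fun σ hσ => by
    have := hs0 σ
    have := hτ0 σ
    positivity
  have hLeq : ∀ᶠ σ in 𝓝[>] 0, μL σ = σ * (τ σ - s σ) := by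
    filter_upwards [hσpos, h2sτ] with σ h1 h2
    exact max_eq_right (mul_nonneg h1.le (by linarith [hs0 σ]))
  have hLb : AsympEquiv μL b := by
    have h1 : Tendsto (fun σ => 1 - s σ / τ σ) (𝓝[>] 0) (𝓝 1) := by
      simpa using hsτ.const_sub 1
    refine h1.congr' ?_
    filter_upwards [hσpos, hτpos, hLeq] with σ h1 h2 h3
    rw [h3, hbτ σ h1]
    field_simp
  have hUb : AsympEquiv μU b := by
    have h1 : Tendsto (fun σ => 1 + 3 * (s σ / τ σ)) (𝓝[>] 0) (𝓝 1) := by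
      simpa using (hsτ.const_mul 3).const_add 1
    refine h1.congr' ?_
    filter_upwards [hσpos, hτpos] with σ h1 h2
    rw [hμU, hbτ σ h1]
    field_simp
  have hLU : AsympEquiv μL μU := by
    have h1 := hLb.div hUb one_ne_zero
    rw [div_one] at h1
    refine h1.congr' ?_
    filter_upwards [hσpos, hτpos] with σ h1 h2
    have : b σ ≠ 0 := by
      rw [hbτ σ h1]
      positivity
    exact div_div_div_cancel_right₀ this _ _
  have hbpos : ∀ᶠ σ in 𝓝[>] 0, 0 < b σ := by
    filter_upwards [hσpos, hτpos] with σ h1 h2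
    rw [hbτ σ h1]
    positivity
  have hupper : ∀ μ : ℝ → ℝ, (∀ σ, 0 < σ → 0 ≤ μ σ) → EventuallyLE μU μ →
      Tendsto (fun σ => minimaxError A ξ e σ (alternative A u (J σ) (μ σ))) (𝓝[>] 0) (𝓝 0) := by
    intro μ _ hμ
    have h1 : Tendsto (fun σ => Real.exp 2 * (τ σ ^ 2 * Real.exp (-τ σ))
        + 2 * Real.exp (-(s σ ^ 2 / 4))) (𝓝[>] 0) (𝓝 0) := by
      have h2 := ((Real.tendsto_pow_mul_exp_neg_atTop_nhds_zero 2).comp hτtop).const_mul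
        (Real.exp 2)
      have h3 := (Real.tendsto_exp_neg_atTop_nhds_zero.comp
        (((tendsto_pow_atTop two_ne_zero).comp hs_top).atTop_div_const
          (by norm_num : (0 : ℝ) < 4))).const_mul 2
      simpa using h2.add h3
    have h2 := ENNReal.tendsto_ofReal h1
    rw [ENNReal.ofReal_zero] at h2
    refine tendsto_of_tendsto_of_tendsto_of_le_of_le' tendsto_const_nhds h2
      (Eventually.of_forall fun _ => zero_le) ?_
    filter_upwards [hσpos, hτtop.eventually_ge_atTop 1, hspos, h2sτ, hu, eventuallyLE_iff.1 hμ,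
      hN.eventually_ge_atTop 1] with σ h1 h2 h3 h4 h5 h6 h7
    refine (minimaxError_le A hξ e u h5 h1 (t := τ σ + s σ) (r := s σ)
      (θ := 1 - (τ σ ^ 2)⁻¹) (by linarith) (by linarith) ?_ ?_ ?_).trans
      (ENNReal.ofReal_le_ofReal ?_)
    · refine lt_of_lt_of_le ?_ h6
      exact mul_lt_mul_of_pos_left (by linarith) h1
    · rw [sub_nonneg]
      exact inv_le_one_of_one_le₀ (one_le_pow₀ h2)
    · have : 0 < (τ σ ^ 2)⁻¹ := by positivity
      linarith
    · have := card_mul_exp_div_le h7 (τ := τ σ) rfl (by linarith) h3 (by linarith)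
      linarith
  have hlower : ∀ μ : ℝ → ℝ, (∀ σ, 0 < σ → 0 ≤ μ σ) → EventuallyLE μ μL →
      Tendsto (fun σ => minimaxError A ξ e σ (alternative A u (J σ) (μ σ))) (𝓝[>] 0) (𝓝 1) := by
    intro μ _ hμ
    have hMs : Tendsto (fun σ => maxNonnegCorrelated A u (J σ) * Real.exp (-s σ ^ 2))
        (𝓝[>] 0) (𝓝 0) := by
      refine hM.congr' ?_
      filter_upwards [hεlog.eventually_ge_atTop 0, hN.eventually_ge_atTop 1] with σ h1 h2
      have h3 : (0 : ℝ) < (J σ).card := by exact_mod_cast h2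
      rw [hs]
      beta_reduce
      rw [Real.sq_sqrt h1, Real.rpow_def_of_pos h3]
      congr 2
      ring
    have h1 : Tendsto (fun σ => 1 - √(2 * Real.exp (-s σ ^ 2 / 2)
        + maxNonnegCorrelated A u (J σ) * Real.exp (-s σ ^ 2))) (𝓝[>] 0) (𝓝 1) := by
      have h3 := (Real.tendsto_exp_neg_atTop_nhds_zero.comp
        (((tendsto_pow_atTop two_ne_zero).comp hs_top).atTop_div_const
          (by norm_num : (0 : ℝ) < 2))).const_mul 2
      simpa [neg_div] using (h3.add hMs).sqrt.const_sub 1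
    have h2 := ENNReal.tendsto_ofReal h1
    rw [ENNReal.ofReal_one] at h2
    refine tendsto_of_tendsto_of_tendsto_of_le_of_le' h2 tendsto_const_nhds ?_
      (Eventually.of_forall fun _ => minimaxError_le_one A ξ e _ _)
    filter_upwards [hσpos, h2sτ, hu, eventuallyLE_iff.1 hμ, hN.eventually_ge_atTop 1, hLeq]
      with σ h1 h2 h3 h4 h5 h6
    exact one_sub_sqrt_le_minimaxError A hξ e u (Finset.card_pos.1 h5) h3 h1 (hs0 σ) h2 rfl
      (h4.trans_eq h6)
  refine ⟨⟨fun σ _ => Real.sqrt_nonneg _, μL, μU, hL0, hU0, hupper, hlower, hLU, ?_, ?_⟩, ?_⟩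
  · rw [eventuallyLE_iff]
    filter_upwards [hσpos, hLeq] with σ h1 h2
    rw [h2]
    refine le_trans ?_ (hbτ σ h1).ge
    exact mul_le_mul_of_nonneg_left (by linarith [hs0 σ]) h1.le
  · rw [eventuallyLE_iff]
    filter_upwards [hσpos] with σ h1
    refine (hbτ σ h1).le.trans ?_
    exact mul_le_mul_of_nonneg_left (by linarith [hs0 σ]) h1.le
  · exact fun μs h => h.asympEquiv hL0 hupper hlower hbpos hLb hUb
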